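/- Let $m$ be a dimension, let $\tau>0$, and let $u,v$ be complex-valued functions that are analytic (in a neighbourhood of every point) on the closed polydisc $\{\mathbf s\in\mathbb C^m:\|\mathbf s\|\le\tau\}$, where $\|\mathbf s\|=\max_j|s_j|$. Write $\nabla u(\mathbf 0)$ and $H_u(\mathbf 0)$ for the gradient and the Hessian of $u$ at the origin. Let $(\boldsymbol\Omega_n)$ be a sequence of $m$-dimensional real random vectors (possibly on different probability spaces), and let $(\varphi_n)$, $(\kappa_n)$ be real sequences with $\varphi_n\to\infty$ and $\kappa_n\to\infty$, such that the moment generating functions exist and satisfy $$\mathbb E\bigl(e^{\langle\boldsymbol\Omega_n,\mathbf s\rangle}\bigr)=e^{u(\mathbf s)\varphi_n+v(\mathbf s)}\bigl(1+O(\kappa_n^{-1})\bigr)\qquad(n\to\infty)$$ uniformly for $\mathbf s\in\mathbb C^m$ with $\|\mathbf s\|\le\tau$, where $\langle\boldsymbol\Omega_n,\mathbf s\rangle=\sum_j\Omega_{n,j}s_j$. Then $\nabla u(\mathbf 0)$ and $H_u(\mathbf 0)$ are real, $H_u(\mathbf 0)$ is positive semidefinite, and the following hold. (a) Whether or not $H_u(\mathbf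 0)$ is singular, the random vectors $$\mathbf X_n=\frac{\boldsymbol\Omega_n-\nabla u(\mathbf 0)\,\varphi_n}{\sqrt{\varphi_n}}$$ converge in distribution to the normal distribution with mean $\mathbf 0$ and variance-covariance matrix $H_u(\mathbf 0)$ (which is degenerate if $H_u(\mathbf 0)$ is singular). (b) If $H_u(\mathbf 0)$ is non-singular, then it is positive definite, and $$\sup_{\mathbf x\in\mathbb R^m}\bigl|\mathbb P(\mathbf X_n\le\mathbf x)-\Phi_{H_u(\mathbf 0)}(\mathbf x)\bigr|=O\bigl(\varphi_n^{-1/2}\bigr)\qquad(n\to\infty),$$ that is, there is a constant $C$ such that the left-hand side is at most $C\varphi_n^{-1/2}$ for all sufficiently large $n$; the constant $C$ can be chosen depending only on $m$, $\tau$, $u$ and $v$. Here $\le$ between vectors is meant componentwise, and $$\Phi_\Sigma(\mathbf x)=\frac1{(2\pi)^{m/2}\sqrt{\det\Sigma}}\int_{\mathbf y\le\mathbf x}\exp\Bigl(-\tfrac12\mathbf y^\top\Sigma^{-1}\mathbf y\Bigr)\,d\mathbf y .$$ -/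

import Mathlib

open MeasureTheory ProbabilityTheory Filter Topology

noncomputable section

namespace QuasiPower

/-- The complex gradient at the origin: the vector of the partial derivatives of `u` at `0`. -/
def cGrad {m : ℕ} (u : (Fin m → ℂ) → ℂ) (j : Fin m) : ℂ :=
  fderiv ℂ u 0 (Pi.single j 1)

/-- The complex Hessian at the origin: the matrix of the second partial derivatives of `u` at
`0`. -/
def cHess {m : ℕ} (u : (Fin m → ℂ) → ℂ) : Matrix (Fin m) (Fin m) ℂ :=
  Matrix.of fun j k =>
    fderiv ℂ (fun s => fderiv ℂ u s (Pi.single k 1)) 0 (Pi.single j 1)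

/-- The gradient at the origin as a real vector (entrywise real part; the theorem asserts that
nothing is lost). -/
def grad {m : ℕ} (u : (Fin m → ℂ) → ℂ) : EuclideanSpace ℝ (Fin m) :=
  WithLp.toLp 2 fun j => (cGrad u j).re

/-- The Hessian at the origin as a real matrix (entrywise real part; the theorem asserts that
nothing is lost). -/
def hess {m : ℕ} (u : (Fin m → ℂ) → ℂ) : Matrix (Fin m) (Fin m) ℝ :=
  (cHess u).map Complex.re

/-- The bilinear pairing `∑ x_j s_j` of a real vector with a complex vector. -/
def pairing {m : ℕ} (x : EuclideanSpace ℝ (Fin m)) (s : Fin m → ℂ) : ℂ :=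
  ∑ j, (x j : ℂ) * s j

/-- The quasi-power hypothesis: `φ n → ∞`, `κ n → ∞`, and the moment generating functions
`M_n(s) = E exp ⟨Ω_n, s⟩` exist and satisfy
`M_n(s) = exp (u s * φ n + v s) * (1 + O(1 / κ n))` as `n → ∞`, uniformly for `s ∈ ℂ^m` with
`‖s‖ ≤ τ`, where `‖s‖` is the maximum norm. -/
structure IsQuasiPower {m : ℕ} (τ : ℝ) (u v : (Fin m → ℂ) → ℂ) (φ κ : ℕ → ℝ)
    {S : ℕ → Type*} [∀ n, MeasurableSpace (S n)] (P : ∀ n, Measure (S n))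
    (Ω : ∀ n, S n → EuclideanSpace ℝ (Fin m)) : Prop where
  tendsto_φ : Tendsto φ atTop atTop
  tendsto_κ : Tendsto κ atTop atTop
  mgf : ∃ B : ℝ, ∀ᶠ n in atTop, ∀ s : Fin m → ℂ, ‖s‖ ≤ τ →
    Integrable (fun ω => Complex.exp (pairing (Ω n ω) s)) (P n) ∧
    ∃ E : ℂ, ‖E‖ ≤ B / κ n ∧
      ∫ ω, Complex.exp (pairing (Ω n ω) s) ∂(P n) =
        Complex.exp (u s * (φ n : ℂ) + v s) * (1 + E)

/-- The normalised random vectors `(Ω_n - ∇u(0) φ_n) / √φ_n`. -/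
def normalised {m : ℕ} (u : (Fin m → ℂ) → ℂ) (φ : ℕ → ℝ) {S : ℕ → Type*}
    (Ω : ∀ n, S n → EuclideanSpace ℝ (Fin m)) (n : ℕ) (ω : S n) : EuclideanSpace ℝ (Fin m) :=
  (√(φ n))⁻¹ • (Ω n ω - φ n • grad u)

/-- The distribution function of the non-degenerate centred normal distribution with
variance-covariance matrix `A`. -/
def normalCdf {m : ℕ} (A : Matrix (Fin m) (Fin m) ℝ) (x : Fin m → ℝ) : ℝ :=
  1 / ((2 * Real.pi) ^ ((m : ℝ) / 2) * √A.det) *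
    ∫ y in {y : Fin m → ℝ | ∀ l, y l ≤ x l}, Real.exp (-(1 / 2) * (y ⬝ᵥ A⁻¹.mulVec y))

end QuasiPower

end

/-!
The moment generating functions `M_n` of `Ω_n` control everything through one expansion,
`exists_mgf_expansion`: for `z` in a fixed neighbourhood of the origin and all large `n`,
`M_n(z) = exp (φ_n (⟨∇u(0), z⟩ + ½ zᵀ H z) + D)` with `|D| ≤ C (‖z‖ + φ_n ‖z‖³)`, where `C` depends
only on `τ`, `u` and `v`. The terms from `u` and `v` are Taylor's formula. The factor `1 + E` of the
hypothesis is divided by its value at the origin, which is harmless as `M_n(0) = 1`; being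
holomorphic on lines through the origin and bounded, it then contributes only `O(‖z‖)` to the
exponent by the Schwarz lemma, whatever the speed of `κ_n → ∞`.

At the scale `z = x / φ_n` the expansion exhibits `exp ⟨∇u(0), x⟩` as a limit of nonnegative numbers
for all real `x`, so the gradient is real; at the scale `z = x / √φ_n` the same argument applies to
`exp (½ xᵀ H x)` and the Hessian is real, while purely imaginary arguments and `|M_n(ix)| ≤ 1` show
that it is positive semidefinite. Convergence in distribution is then Lévy's theorem.

The rate of convergence rests on a smoothing inequality (`exists_smoothing_inequality`). The
indicator of an orthant is not integrable, so that a bound on the difference of the characteristic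
functions of `X_n` and of the Gaussian law does not directly bound the difference of the
distribution functions. Here both laws are multiplied by the weight `w(y) = 1 + ∑ j, (exp y_j +
exp (-y_j))` and the indicator is divided by it. The Fourier transform of a weighted law is a
finite sum of values of its moment generating function at points `σ + i t` with bounded real part
`σ`, which the expansion above compares with the Gaussian ones for `‖t‖ ≤ c √φ_n`, with an error
`O(φ_n^{-1/2})` times a Gaussian function of `t`. Inverse Fourier transformation against a band
limited kernel `K` at scale `φ_n^{-1/2}` gives a uniform bound for the difference of the densities
of the smoothed weighted laws; it is integrated against `1 / w`, which is integrable. Since `1 /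
w` is also Lipschitz, exchanging it with the convolution by `K` costs only `O(φ_n^{-1/2})`, and
the smoothing itself is removed by the usual monotonicity argument (`abs_sub_le_of_smoothed`).
-/

noncomputable section

namespace QuasiPower

open scoped RealInnerProductSpace MatrixOrder

/-! ### Moment generating functions on complex lines -/

lemma norm_pairing_le {m : ℕ} (x : EuclideanSpace ℝ (Fin m)) (s : Fin m → ℂ) :
    ‖pairing x s‖ ≤ (∑ j, |x j|) * ‖s‖ := by
  rw [pairing, Finset.sum_mul]
  refine (norm_sum_le _ _).trans (Finset.sum_le_sum fun j _ => ?_)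
  rw [norm_mul, Complex.norm_real, Real.norm_eq_abs]
  exact mul_le_mul_of_nonneg_left (norm_le_pi_norm s j) (abs_nonneg _)

lemma pairing_smul {m : ℕ} (x : EuclideanSpace ℝ (Fin m)) (c : ℂ) (s : Fin m → ℂ) :
    pairing x (c • s) = c * pairing x s := by
  simp only [pairing, Pi.smul_apply, smul_eq_mul, Finset.mul_sum]
  exact Finset.sum_congr rfl fun j _ => by ring

lemma pairing_zero {m : ℕ} (x : EuclideanSpace ℝ (Fin m)) : pairing x 0 = 0 := by
  simp [pairing]

@[fun_prop]
lemma continuous_pairing {m : ℕ} (s : Fin m → ℂ) :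
    Continuous fun x : EuclideanSpace ℝ (Fin m) => pairing x s := by
  unfold pairing; fun_prop

/-- If the moment generating function exists on the closed polydisc of radius `τ`, then
`exp (τ ‖Ω‖₁)` is integrable: it is dominated by the sum of the exponentials of the `2 ^ m` signed
sums of the coordinates. -/
lemma integrable_exp_sum_abs {m : ℕ} {τ : ℝ} (hτ : 0 < τ) {S : Type*} [MeasurableSpace S]
    {P : Measure S} {Ω : S → EuclideanSpace ℝ (Fin m)} (hΩ : Measurable Ω)
    (h : ∀ s : Fin m → ℂ, ‖s‖ ≤ τ → Integrable (fun ω => Complex.exp (pairing (Ω ω) s)) P) :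
    Integrable (fun ω => Real.exp (τ * ∑ j, |Ω ω j|)) P := by
  let sg : (Fin m → Bool) → Fin m → ℂ := fun ε j => if ε j then (τ : ℂ) else -(τ : ℂ)
  have hsg : ∀ ε, ‖sg ε‖ ≤ τ := fun ε => by
    refine (pi_norm_le_iff_of_nonneg hτ.le).2 fun j => ?_
    simp only [sg]
    split_ifs <;> simp [abs_of_pos hτ]
  have hint : Integrable (fun ω => ∑ ε : Fin m → Bool, ‖Complex.exp (pairing (Ω ω) (sg ε))‖) P :=
    integrable_finsetSum _ fun ε _ => (h _ (hsg ε)).norm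
  refine hint.mono' (by fun_prop) (ae_of_all _ fun ω => ?_)
  rw [Real.norm_eq_abs, Real.abs_exp]
  let ε : Fin m → Bool := fun j => decide (0 ≤ Ω ω j)
  have hε : ‖Complex.exp (pairing (Ω ω) (sg ε))‖ = Real.exp (τ * ∑ j, |Ω ω j|) := by
    rw [Complex.norm_exp, pairing, Complex.re_sum, Finset.mul_sum]
    congr 1
    refine Finset.sum_congr rfl fun j _ => ?_
    by_cases hj : 0 ≤ Ω ω j
    · simp [sg, ε, hj, abs_of_nonneg hj, mul_comm]
    · simp [sg, ε, hj, abs_of_neg (not_le.1 hj), mul_comm]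
  rw [← hε]
  exact Finset.single_le_sum (f := fun ε => ‖Complex.exp (pairing (Ω ω) (sg ε))‖)
    (fun _ _ => norm_nonneg _) (Finset.mem_univ ε)

/-- The moment generating function is holomorphic along complex lines through the origin. -/
lemma differentiableOn_mgf_line {m : ℕ} {τ : ℝ} (hτ : 0 < τ) {S : Type*} [MeasurableSpace S]
    {P : Measure S} {Ω : S → EuclideanSpace ℝ (Fin m)} (hΩ : Measurable Ω)
    (h : ∀ s : Fin m → ℂ, ‖s‖ ≤ τ → Integrable (fun ω => Complex.exp (pairing (Ω ω) s)) P)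
    {z : Fin m → ℂ} (hz : z ≠ 0) :
    DifferentiableOn ℂ (fun w : ℂ => ∫ ω, Complex.exp (pairing (Ω ω) (w • z)) ∂P)
      (Metric.ball 0 (τ / ‖z‖)) := by
  intro w₀ hw₀
  have hz' : 0 < ‖z‖ := norm_pos_iff.2 hz
  rw [mem_ball_zero_iff, lt_div_iff₀ hz'] at hw₀
  obtain ⟨ρ, hρ₁, hρ₂⟩ := exists_between hw₀
  have hr : 0 < ρ / ‖z‖ - ‖w₀‖ := by
    rw [sub_pos, lt_div_iff₀ hz']; exact hρ₁
  have hball : ∀ w ∈ Metric.ball w₀ (ρ / ‖z‖ - ‖w₀‖), ‖w‖ * ‖z‖ ≤ ρ := by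
    intro w hw
    rw [mem_ball_iff_norm] at hw
    have : ‖w‖ ≤ ρ / ‖z‖ := by
      have := norm_le_norm_add_norm_sub' w w₀
      linarith
    exact (le_div_iff₀ hz').1 this
  have key := hasDerivAt_integral_of_dominated_loc_of_deriv_le (μ := P) (𝕜 := ℂ)
    (F := fun w ω => Complex.exp (pairing (Ω ω) (w • z)))
    (F' := fun w ω => pairing (Ω ω) z * Complex.exp (pairing (Ω ω) (w • z)))
    (x₀ := w₀) (s := Metric.ball w₀ (ρ / ‖z‖ - ‖w₀‖))
    (bound := fun ω => ‖z‖ / (τ - ρ) * Real.exp (τ * ∑ j, |Ω ω j|))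
    (Metric.ball_mem_nhds _ hr)
    (Eventually.of_forall fun w => by
      have : Continuous fun x : EuclideanSpace ℝ (Fin m) => Complex.exp (pairing x (w • z)) := by
        fun_prop
      exact (this.measurable.comp hΩ).aestronglyMeasurable)
    (h _ (by rw [norm_smul]; exact hw₀.le))
    (by
      have : Continuous fun x : EuclideanSpace ℝ (Fin m) =>
          pairing x z * Complex.exp (pairing x (w₀ • z)) := by
        fun_prop
      exact (this.measurable.comp hΩ).aestronglyMeasurable)
    (ae_of_all _ fun ω w hw => ?_)
    ((integrable_exp_sum_abs hτ hΩ h).const_mul _)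
    (ae_of_all _ fun ω w hw => ?_)
  · exact key.2.differentiableAt.differentiableWithinAt
  · have hS : 0 ≤ ∑ j, |Ω ω j| := Finset.sum_nonneg fun _ _ => abs_nonneg _
    have h1 := norm_pairing_le (Ω ω) z
    have h2 : ‖Complex.exp (pairing (Ω ω) (w • z))‖ ≤ Real.exp (ρ * ∑ j, |Ω ω j|) := by
      rw [Complex.norm_exp]
      refine Real.exp_le_exp.2 ((Complex.re_le_norm _).trans ((norm_pairing_le _ _).trans ?_))
      rw [norm_smul, mul_comm ρ]
      exact mul_le_mul_of_nonneg_left (hball w hw) hS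
    -- trade the factor `∑ |Ω_j|` for a slightly larger exponent
    have h3 : (∑ j, |Ω ω j|) ≤ Real.exp ((τ - ρ) * ∑ j, |Ω ω j|) / (τ - ρ) := by
      rw [le_div_iff₀ (by linarith), mul_comm]
      linarith [Real.add_one_le_exp ((τ - ρ) * ∑ j, |Ω ω j|)]
    calc ‖pairing (Ω ω) z * Complex.exp (pairing (Ω ω) (w • z))‖
        ≤ (Real.exp ((τ - ρ) * ∑ j, |Ω ω j|) / (τ - ρ) * ‖z‖) * Real.exp (ρ * ∑ j, |Ω ω j|) := by
          rw [norm_mul]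
          exact mul_le_mul (h1.trans (mul_le_mul_of_nonneg_right h3 hz'.le)) h2 (norm_nonneg _)
            (by have := sub_pos.2 hρ₂; positivity)
      _ = ‖z‖ / (τ - ρ) * Real.exp (τ * ∑ j, |Ω ω j|) := by
          rw [show τ * ∑ j, |Ω ω j| = (τ - ρ) * ∑ j, |Ω ω j| + ρ * ∑ j, |Ω ω j| by ring,
            Real.exp_add]
          ring
  · simp only [pairing_smul]
    have := ((hasDerivAt_id w).mul_const (pairing (Ω ω) z)).cexp
    simpa [mul_comm] using this

/-- A multiplicative error that is bounded on a polydisc is `exp (O(‖z‖))` after normalisation at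
the origin. Since the error factor is holomorphic and the moment generating function equals `1` at
the origin, this follows from the Schwarz lemma on the line through `0` and `z`. -/
lemma exists_mgf_eq_exp_sub_add {m : ℕ} {τ : ℝ} (hτ : 0 < τ) {S : Type*} [MeasurableSpace S]
    {P : Measure S} [IsProbabilityMeasure P] {Ω : S → EuclideanSpace ℝ (Fin m)}
    (hΩ : Measurable Ω) {f : (Fin m → ℂ) → ℂ} (hf : ∀ z, ‖z‖ ≤ τ → DifferentiableAt ℂ f z)
    (h : ∀ s : Fin m → ℂ, ‖s‖ ≤ τ → Integrable (fun ω => Complex.exp (pairing (Ω ω) s)) P ∧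
      ∃ E : ℂ, ‖E‖ ≤ 1 / 4 ∧
        ∫ ω, Complex.exp (pairing (Ω ω) s) ∂P = Complex.exp (f s) * (1 + E))
    {z : Fin m → ℂ} (hz : ‖z‖ ≤ 3 / 8 * τ) :
    ∃ D : ℂ, ‖D‖ ≤ 2 / τ * ‖z‖ ∧
      ∫ ω, Complex.exp (pairing (Ω ω) z) ∂P = Complex.exp (f z - f 0 + D) := by
  rcases eq_or_ne z 0 with rfl | hz0
  · exact ⟨0, by simp, by simp [pairing_zero]⟩
  have hz' : 0 < ‖z‖ := norm_pos_iff.2 hz0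
  set M : (Fin m → ℂ) → ℂ := fun s => ∫ ω, Complex.exp (pairing (Ω ω) s) ∂P with hM
  let E : (Fin m → ℂ) → ℂ := fun s => M s * Complex.exp (-f s) - 1
  have hE : ∀ s, ‖s‖ ≤ τ → ‖E s‖ ≤ 1 / 4 := by
    intro s hs
    obtain ⟨e, he, h'⟩ := (h s hs).2
    have : E s = e := by
      simp only [E, hM, h']
      rw [mul_right_comm, ← Complex.exp_add]
      simp
    rwa [this]
  have hM0 : M 0 = 1 := by simp [hM, pairing_zero]
  have hME : ∀ s, M s = Complex.exp (f s) * (1 + E s) := by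
    intro s
    simp only [E]
    rw [add_sub_cancel, mul_left_comm, ← Complex.exp_add]
    simp
  have hline : ∀ w ∈ Metric.ball (0 : ℂ) (τ / ‖z‖), ‖w • z‖ ≤ τ := by
    intro w hw
    rw [mem_ball_zero_iff, lt_div_iff₀ hz'] at hw
    rw [norm_smul]; exact hw.le
  have hdiff : DifferentiableOn ℂ (fun w : ℂ => E (w • z)) (Metric.ball 0 (τ / ‖z‖)) := by
    refine DifferentiableOn.sub_const (DifferentiableOn.mul
      (differentiableOn_mgf_line hτ hΩ (fun s hs => (h s hs).1) hz0) ?_) _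
    refine DifferentiableOn.cexp (DifferentiableOn.neg fun w hw => ?_)
    exact (DifferentiableAt.comp w (hf _ (hline w hw))
      (by fun_prop)).differentiableWithinAt
  have h1ball : (1 : ℂ) ∈ Metric.ball (0 : ℂ) (τ / ‖z‖) := by
    rw [mem_ball_zero_iff, norm_one, lt_div_iff₀ hz']; linarith
  have hτz : 0 < τ / ‖z‖ := div_pos hτ hz'
  have hschw := Complex.dist_le_div_mul_dist_of_mapsTo_ball (R₂ := 1) hdiff
    (fun w hw => by
      rw [mem_closedBall_iff_norm]
      have h1 := hE _ (hline w hw)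
      have h2 := hE ((0 : ℂ) • z) (by simp [hτ.le])
      exact (norm_sub_le _ _).trans (by linarith)) h1ball
  rw [dist_eq_norm, one_smul, zero_smul, dist_zero_right, norm_one, mul_one, one_div_div] at hschw
  have h0 := hE 0 (by simp [hτ.le])
  have hpos : 3 / 4 ≤ ‖1 + E 0‖ := by
    have := norm_sub_norm_le (1 : ℂ) (-E 0)
    rw [norm_neg, norm_one, sub_neg_eq_add] at this
    linarith
  have hne : 1 + E 0 ≠ 0 := norm_pos_iff.1 (by linarith)
  set R := (E z - E 0) / (1 + E 0) with hR
  have hRn : ‖R‖ ≤ 4 / 3 * (‖z‖ / τ) := by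
    rw [hR, norm_div, div_le_iff₀ (by linarith)]
    have : 0 ≤ ‖z‖ / τ := by positivity
    nlinarith
  have hzτ : ‖z‖ / τ ≤ 3 / 8 := (div_le_iff₀ hτ).2 hz
  have hR2 : ‖R‖ ≤ 1 / 2 := by linarith
  refine ⟨Complex.log (1 + R), (Complex.norm_log_one_add_half_le_self hR2).trans ?_, ?_⟩
  · calc 3 / 2 * ‖R‖ ≤ 3 / 2 * (4 / 3 * (‖z‖ / τ)) := by linarith
      _ = _ := by ring
  · have hR1 : 1 + R ≠ 0 := by
      intro h
      have : R = -1 := by linear_combination h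
      rw [this] at hR2; norm_num at hR2
    change M z = _
    rw [Complex.exp_add, Complex.exp_sub, Complex.exp_log hR1]
    have h3 := hME 0
    rw [hM0] at h3
    rw [hME z, hR]
    field_simp
    linear_combination (-(1 + E z)) * h3

/-! ### Taylor expansion at the origin -/

lemma fderiv_zero_apply_eq_sum {m : ℕ} (u : (Fin m → ℂ) → ℂ) (z : Fin m → ℂ) :
    fderiv ℂ u 0 z = ∑ j, cGrad u j * z j := by
  conv_lhs => rw [pi_eq_sum_univ' z]
  rw [map_sum]
  refine Finset.sum_congr rfl fun j _ => ?_
  rw [map_smul, smul_eq_mul, cGrad, mul_comm]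

lemma cHess_apply {m : ℕ} {u : (Fin m → ℂ) → ℂ} (hu : AnalyticAt ℂ u 0) (j k : Fin m) :
    cHess u j k = fderiv ℂ (fderiv ℂ u) 0 (Pi.single j 1) (Pi.single k 1) := by
  have h := hu.fderiv.differentiableAt
  rw [cHess, Matrix.of_apply, fderiv_clm_apply h (by fun_prop)]
  simp

lemma cHess_symm {m : ℕ} {u : (Fin m → ℂ) → ℂ} (hu : AnalyticAt ℂ u 0) (j k : Fin m) :
    cHess u j k = cHess u k j := by
  rw [cHess_apply hu, cHess_apply hu]
  have : ContDiffAt ℂ ⊤ u 0 := hu.contDiffAt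
  exact this.isSymmSndFDerivAt (by simp) _ _

lemma fderiv_fderiv_zero_apply_eq {m : ℕ} {u : (Fin m → ℂ) → ℂ} (hu : AnalyticAt ℂ u 0)
    (z : Fin m → ℂ) : fderiv ℂ (fderiv ℂ u) 0 z z = z ⬝ᵥ (cHess u).mulVec z := by
  have hz : z = ∑ j, z j • (Pi.single j 1 : Fin m → ℂ) := pi_eq_sum_univ' z
  conv_lhs => rw [hz]
  simp only [map_sum, map_smul, _root_.sum_apply, _root_.smul_apply,
    ← cHess_apply hu, dotProduct, Matrix.mulVec, smul_eq_mul, Finset.mul_sum]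
  rw [Finset.sum_comm]
  refine Finset.sum_congr rfl fun j _ => Finset.sum_congr rfl fun k _ => by ring

/-- The exponent of the Gaussian approximation: the second order Taylor polynomial of `u` without
its constant term. -/
def taylorTwo {m : ℕ} (u : (Fin m → ℂ) → ℂ) (z : Fin m → ℂ) : ℂ :=
  (∑ j, cGrad u j * z j) + 1 / 2 * (z ⬝ᵥ (cHess u).mulVec z)

/-- Second order Taylor expansion at the origin of an analytic function of several variables. -/
lemma exists_taylor_two {m : ℕ} {u : (Fin m → ℂ) → ℂ} (hu : AnalyticAt ℂ u 0) :
    ∃ C r : ℝ, 0 < C ∧ 0 < r ∧ ∀ z : Fin m → ℂ, ‖z‖ ≤ r →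
      ‖u z - u 0 - taylorTwo u z‖ ≤ C * ‖z‖ ^ 3 := by
  obtain ⟨p, hp⟩ := hu
  have hO := hp.isBigO_sub_partialSum_pow 3
  obtain ⟨C, hC, hb⟩ := hO.exists_pos
  rw [Asymptotics.IsBigOWith] at hb
  obtain ⟨r, hr, hb⟩ := Metric.eventually_nhds_iff.1 hb
  refine ⟨C, r / 2, hC, by positivity, fun z hz => ?_⟩
  have h := hb (y := z) (by rw [dist_zero_right]; linarith)
  rw [zero_add] at h
  obtain ⟨R, hpR⟩ := hp
  have h1 := hpR.factorial_smul z 1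
  have h2 := hpR.factorial_smul z 2
  have h0 := hpR.coeff_zero (fun _ => z)
  simp only [Nat.factorial, iteratedFDeriv_one_apply, iteratedFDeriv_two_apply] at h1 h2
  rw [FormalMultilinearSeries.partialSum] at h
  simp only [Finset.sum_range_succ, Finset.sum_range_zero, zero_add, h0] at h
  rw [fderiv_zero_apply_eq_sum] at h1
  rw [fderiv_fderiv_zero_apply_eq hpR.analyticAt] at h2
  rw [taylorTwo, ← h1, ← h2]
  rw [norm_pow, norm_norm] at h
  refine (congrArg norm ?_).le.trans h
  simp only [nsmul_eq_mul]
  push_cast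
  ring

lemma exists_lipschitz_zero {m : ℕ} {v : (Fin m → ℂ) → ℂ} (hv : DifferentiableAt ℂ v 0) :
    ∃ C r : ℝ, 0 < C ∧ 0 < r ∧ ∀ z : Fin m → ℂ, ‖z‖ ≤ r → ‖v z - v 0‖ ≤ C * ‖z‖ := by
  obtain ⟨C, hC, hb⟩ := hv.isBigO_sub.exists_pos
  rw [Asymptotics.IsBigOWith] at hb
  obtain ⟨r, hr, hb⟩ := Metric.eventually_nhds_iff.1 hb
  refine ⟨C, r / 2, hC, by positivity, fun z hz => ?_⟩
  simpa using hb (y := z) (by rw [dist_zero_right]; linarith)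

/-- The moment generating function near the origin. The constants depend only on `τ`, `u` and `v`:
the `O(1 / κ_n)` factor of the hypothesis contributes `O(‖z‖)` to the exponent whatever the speed
of convergence of `κ_n`. -/
lemma exists_mgf_expansion {m : ℕ} {τ : ℝ} (hτ : 0 < τ) {u v : (Fin m → ℂ) → ℂ}
    (hu : AnalyticOnNhd ℂ u {s | ‖s‖ ≤ τ}) (hv : AnalyticOnNhd ℂ v {s | ‖s‖ ≤ τ}) :
    ∃ C r : ℝ, 0 < C ∧ 0 < r ∧ ∀ (S : ℕ → Type*) [∀ n, MeasurableSpace (S n)]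
      (P : ∀ n, Measure (S n)) [∀ n, IsProbabilityMeasure (P n)]
      (Ω : ∀ n, S n → EuclideanSpace ℝ (Fin m)) (φ κ : ℕ → ℝ), (∀ n, Measurable (Ω n)) →
      IsQuasiPower τ u v φ κ P Ω → ∀ᶠ n in atTop, ∀ z : Fin m → ℂ, ‖z‖ ≤ r →
        Integrable (fun ω => Complex.exp (pairing (Ω n ω) z)) (P n) ∧
        ∃ D : ℂ, ‖D‖ ≤ C * (‖z‖ + φ n * ‖z‖ ^ 3) ∧
          ∫ ω, Complex.exp (pairing (Ω n ω) z) ∂(P n) =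
            Complex.exp (φ n * taylorTwo u z + D) := by
  have h0 : (0 : Fin m → ℂ) ∈ {s : Fin m → ℂ | ‖s‖ ≤ τ} := by simp [hτ.le]
  obtain ⟨C₁, r₁, hC₁, hr₁, hu'⟩ := exists_taylor_two (hu 0 h0)
  obtain ⟨C₂, r₂, hC₂, hr₂, hv'⟩ := exists_lipschitz_zero (hv 0 h0).differentiableAt
  refine ⟨C₁ + C₂ + 2 / τ, min (min r₁ r₂) (3 / 8 * τ), by positivity, by positivity, ?_⟩
  intro S _ P _ Ω φ κ hΩ hQ
  obtain ⟨B, hB⟩ := hQ.mgf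
  filter_upwards [hB, hQ.tendsto_φ.eventually_ge_atTop 0, (tendsto_const_nhds (x := B)).div_atTop
    hQ.tendsto_κ |>.eventually_le_const (show (0 : ℝ) < 1 / 4 by norm_num)] with n hn hφ hκ z hz
  have hz1 : ‖z‖ ≤ r₁ := hz.trans ((min_le_left _ _).trans (min_le_left _ _))
  have hz2 : ‖z‖ ≤ r₂ := hz.trans ((min_le_left _ _).trans (min_le_right _ _))
  have hz3 : ‖z‖ ≤ 3 / 8 * τ := hz.trans (min_le_right _ _)
  refine ⟨(hn z (by linarith)).1, ?_⟩
  obtain ⟨D, hD, hM⟩ := exists_mgf_eq_exp_sub_add hτ (hΩ n)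
    (f := fun s => u s * (φ n : ℂ) + v s)
    (fun z hz => ((hu z hz).differentiableAt.mul_const _).add (hv z hz).differentiableAt)
    (fun s hs => ⟨(hn s hs).1, by
      obtain ⟨E, hE, h⟩ := (hn s hs).2
      exact ⟨E, hE.trans hκ, h⟩⟩) hz3
  refine ⟨(u z - u 0 - taylorTwo u z) * φ n + (v z - v 0) + D, ?_, ?_⟩
  · have h1 : ‖(u z - u 0 - taylorTwo u z) * (φ n : ℂ)‖ ≤ C₁ * ‖z‖ ^ 3 * φ n := by
      rw [norm_mul, Complex.norm_real, Real.norm_of_nonneg hφ]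
      exact mul_le_mul_of_nonneg_right (hu' z hz1) hφ
    have h2 := hv' z hz2
    have h3 : 0 ≤ φ n * ‖z‖ ^ 3 := by positivity
    have h4 : (C₁ + C₂ + 2 / τ) * (‖z‖ + φ n * ‖z‖ ^ 3) = C₁ * ‖z‖ ^ 3 * φ n + C₂ * ‖z‖ +
        2 / τ * ‖z‖ + (C₁ * ‖z‖ + (C₂ + 2 / τ) * (φ n * ‖z‖ ^ 3)) := by ring
    have h5 : 0 ≤ C₁ * ‖z‖ + (C₂ + 2 / τ) * (φ n * ‖z‖ ^ 3) := by positivity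
    refine (norm_add₃_le).trans ?_
    linarith
  · rw [hM]; congr 1; ring

/-! ### Consequences at the scale of the central limit theorem -/

lemma taylorTwo_smul {m : ℕ} (u : (Fin m → ℂ) → ℂ) (c : ℂ) (z : Fin m → ℂ) :
    taylorTwo u (c • z) =
      c * (∑ j, cGrad u j * z j) + 1 / 2 * c ^ 2 * (z ⬝ᵥ (cHess u).mulVec z) := by
  have h1 : ∑ j, cGrad u j * (c • z) j = c * ∑ j, cGrad u j * z j := by
    rw [Finset.mul_sum]
    exact Finset.sum_congr rfl fun j _ => by simp; ring
  rw [taylorTwo, h1, Matrix.mulVec_smul, smul_dotProduct, dotProduct_smul]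
  simp only [smul_eq_mul]
  ring

/-- Second order expansion of the logarithms of the moment generating functions of `Ω_n` at the
scale `1 / √φ_n` of the central limit theorem, with an explicit error term; `C` and `r` do not
depend on `n`. -/
def HasExpansion {m : ℕ} (u : (Fin m → ℂ) → ℂ) {S : ℕ → Type*} [∀ n, MeasurableSpace (S n)]
    (P : ∀ n, Measure (S n)) (Ω : ∀ n, S n → EuclideanSpace ℝ (Fin m)) (φ : ℕ → ℝ) (C r : ℝ) :
    Prop :=
  ∀ᶠ n in atTop, ∀ s : Fin m → ℂ, ‖s‖ ≤ r * √(φ n) →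
    Integrable (fun ω => Complex.exp (pairing (Ω n ω) (((√(φ n) : ℝ) : ℂ)⁻¹ • s))) (P n) ∧
    ∃ D : ℂ, ‖D‖ ≤ C * (‖s‖ + ‖s‖ ^ 3) / √(φ n) ∧
      ∫ ω, Complex.exp (pairing (Ω n ω) (((√(φ n) : ℝ) : ℂ)⁻¹ • s)) ∂(P n) =
        Complex.exp (√(φ n) * (∑ j, cGrad u j * s j) +
          1 / 2 * (s ⬝ᵥ (cHess u).mulVec s) + D)

lemma exists_hasExpansion {m : ℕ} {τ : ℝ} (hτ : 0 < τ) {u v : (Fin m → ℂ) → ℂ}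
    (hu : AnalyticOnNhd ℂ u {s | ‖s‖ ≤ τ}) (hv : AnalyticOnNhd ℂ v {s | ‖s‖ ≤ τ}) :
    ∃ C r : ℝ, 0 < C ∧ 0 < r ∧ ∀ (S : ℕ → Type*) [∀ n, MeasurableSpace (S n)]
      (P : ∀ n, Measure (S n)) [∀ n, IsProbabilityMeasure (P n)]
      (Ω : ∀ n, S n → EuclideanSpace ℝ (Fin m)) (φ κ : ℕ → ℝ), (∀ n, Measurable (Ω n)) →
      IsQuasiPower τ u v φ κ P Ω → HasExpansion u P Ω φ C r := by
  obtain ⟨C, r, hC, hr, H⟩ := exists_mgf_expansion hτ hu hv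
  refine ⟨C, r, hC, hr, ?_⟩
  intro S _ P _ Ω φ κ hΩ hQ
  filter_upwards [H S P Ω φ κ hΩ hQ, hQ.tendsto_φ.eventually_gt_atTop 0] with n hn hφ s hs
  set q := √(φ n) with hq
  have hq0 : 0 < q := Real.sqrt_pos.2 hφ
  have hqφ : q ^ 2 = φ n := Real.sq_sqrt hφ.le
  have hnorm : ‖((q : ℝ) : ℂ)⁻¹ • s‖ = ‖s‖ / q := by
    rw [norm_smul, norm_inv, Complex.norm_real, Real.norm_of_nonneg hq0.le, inv_mul_eq_div]
  obtain ⟨hint, D, hD, hM⟩ := hn ((q : ℂ)⁻¹ • s) (by rw [hnorm, div_le_iff₀ hq0]; exact hs)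
  refine ⟨hint, D, ?_, ?_⟩
  · rw [hnorm, ← hqφ] at hD
    refine hD.trans (le_of_eq ?_)
    field_simp
  · rw [hM, taylorTwo_smul, ← hqφ]
    have : (q : ℂ) ≠ 0 := by exact_mod_cast hq0.ne'
    congr 2
    push_cast
    field_simp

/-- Otherwise `exp (t a)` is negative for `t = π / |im a|`. -/
lemma im_eq_zero_of_exp_nonneg {a : ℂ}
    (h : ∀ t : ℝ, 0 ≤ t → 0 ≤ (Complex.exp (t * a)).re) : a.im = 0 := by
  by_contra ha
  have ht := h (Real.pi / |a.im|) (by positivity)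
  rw [Complex.exp_re] at ht
  have him : (((Real.pi / |a.im| : ℝ) : ℂ) * a).im = Real.pi / |a.im| * a.im := by
    simp
  have hcos : Real.cos (Real.pi / |a.im| * a.im) = -1 := by
    rcases abs_cases a.im with ⟨h1, _⟩ | ⟨h1, _⟩
    · rw [h1, div_mul_cancel₀ _ ha, Real.cos_pi]
    · rw [h1, div_neg, neg_mul, div_mul_cancel₀ _ ha, Real.cos_neg, Real.cos_pi]
  rw [him, hcos] at ht
  have := Real.exp_pos (((Real.pi / |a.im| : ℝ) : ℂ) * a).re
  linarith

lemma pairing_ofReal {m : ℕ} (x : EuclideanSpace ℝ (Fin m)) (y : Fin m → ℝ) :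
    pairing x (fun j => (y j : ℂ)) = ((∑ j, x j * y j : ℝ) : ℂ) := by
  simp [pairing]

section Consequences

variable {m : ℕ} {u : (Fin m → ℂ) → ℂ} {S : ℕ → Type*} [∀ n, MeasurableSpace (S n)]
  {P : ∀ n, Measure (S n)} {Ω : ∀ n, S n → EuclideanSpace ℝ (Fin m)}
  {φ : ℕ → ℝ} {C r : ℝ}

lemma integral_exp_pairing_nonneg {S : Type*} [MeasurableSpace S] {P : Measure S}
    {Ω : S → EuclideanSpace ℝ (Fin m)} (y : Fin m → ℝ) :
    ∃ ρ : ℝ, 0 ≤ ρ ∧ ∫ ω, Complex.exp (pairing (Ω ω) (fun j => (y j : ℂ))) ∂P = ρ := by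
  refine ⟨∫ ω, Real.exp (∑ j, Ω ω j * y j) ∂P, integral_nonneg fun _ => (Real.exp_pos _).le, ?_⟩
  rw [← integral_complex_ofReal]
  simp only [pairing_ofReal, Complex.ofReal_exp]

lemma tendsto_sqrt_of_tendsto (hφ : Tendsto φ atTop atTop) :
    Tendsto (fun n => √(φ n)) atTop atTop :=
  Real.tendsto_sqrt_atTop.comp hφ

lemma HasExpansion.exists_error_tendsto_zero (h : HasExpansion u P Ω φ C r) (hC : 0 < C)
    (hr : 0 < r)
    (hφ : Tendsto φ atTop atTop) (s : Fin m → ℂ) {a : ℕ → ℝ} (ha : ∀ n, |a n| ≤ 1) :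
    ∃ D : ℕ → ℂ, Tendsto D atTop (𝓝 0) ∧ ∀ᶠ n in atTop,
      ∫ ω, Complex.exp (pairing (Ω n ω) (((√(φ n) : ℝ) : ℂ)⁻¹ • ((a n : ℂ) • s))) ∂(P n) =
        Complex.exp (√(φ n) * (∑ j, cGrad u j * ((a n : ℂ) • s) j) +
          1 / 2 * (((a n : ℂ) • s) ⬝ᵥ (cHess u).mulVec ((a n : ℂ) • s)) + D n) := by
  have hq := tendsto_sqrt_of_tendsto hφ
  have hle : ∀ n, ‖(a n : ℂ) • s‖ ≤ ‖s‖ := fun n => by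
    rw [norm_smul, Complex.norm_real, Real.norm_eq_abs]
    exact mul_le_of_le_one_left (norm_nonneg _) (ha n)
  have h2 : ∀ᶠ n in atTop, ∃ D : ℂ, ‖D‖ ≤ C * (‖s‖ + ‖s‖ ^ 3) / √(φ n) ∧
      ∫ ω, Complex.exp (pairing (Ω n ω) (((√(φ n) : ℝ) : ℂ)⁻¹ • ((a n : ℂ) • s))) ∂(P n) =
        Complex.exp (√(φ n) * (∑ j, cGrad u j * ((a n : ℂ) • s) j) +
          1 / 2 * (((a n : ℂ) • s) ⬝ᵥ (cHess u).mulVec ((a n : ℂ) • s)) + D) := by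
    filter_upwards [h, (hq.const_mul_atTop hr).eventually_ge_atTop ‖s‖] with n hn hs
    obtain ⟨-, D, hD, hM⟩ := hn ((a n : ℂ) • s) ((hle n).trans hs)
    refine ⟨D, hD.trans ?_, hM⟩
    gcongr <;> exact hle n
  choose! D hD using h2.exists_forall_of_atTop.choose_spec
  refine ⟨D, ?_, ?_⟩
  · refine squeeze_zero_norm' (a := fun n => C * (‖s‖ + ‖s‖ ^ 3) / √(φ n)) ?_
      (tendsto_const_nhds.div_atTop hq)
    filter_upwards [eventually_ge_atTop h2.exists_forall_of_atTop.choose] with n hn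
    exact (hD n hn).1
  · filter_upwards [eventually_ge_atTop h2.exists_forall_of_atTop.choose] with n hn
    exact (hD n hn).2

/-- At the scale `1 / φ_n` the moment generating functions of `Ω_n` at real points are positive and
converge to `exp ⟨∇u(0), x⟩`, which forces the gradient to be real. -/
lemma HasExpansion.cGrad_im (h : HasExpansion u P Ω φ C r) (hC : 0 < C) (hr : 0 < r)
    (hφ : Tendsto φ atTop atTop) (j : Fin m) : (cGrad u j).im = 0 := by
  refine im_eq_zero_of_exp_nonneg fun t _ => ?_
  have hq := tendsto_sqrt_of_tendsto hφ
  let s : Fin m → ℂ := Pi.single j (t : ℂ)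
  -- cut off so that `|a n| ≤ 1` holds for every `n`
  let a : ℕ → ℝ := fun n => if 1 ≤ √(φ n) then (√(φ n))⁻¹ else 0
  obtain ⟨D, hD, hM⟩ := h.exists_error_tendsto_zero hC hr hφ s (a := a) fun n => by
    simp only [a]
    split_ifs with h1
    · rw [abs_of_nonneg (by positivity)]; exact inv_le_one_of_one_le₀ h1
    · simp
  have ha : ∀ᶠ n in atTop, a n = (√(φ n))⁻¹ ∧ 0 < √(φ n) := by
    filter_upwards [hq.eventually_ge_atTop 1] with n hn
    exact ⟨if_pos hn, by linarith⟩
  have ha0 : Tendsto a atTop (𝓝 0) :=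
    (tendsto_inv_atTop_zero.comp hq).congr' (by
      filter_upwards [ha] with n hn using hn.1.symm)
  have hlim : Tendsto (fun n => Complex.exp ((t : ℂ) * cGrad u j +
      1 / 2 * (a n : ℂ) ^ 2 * (s ⬝ᵥ (cHess u).mulVec s) + D n)) atTop
      (𝓝 (Complex.exp ((t : ℂ) * cGrad u j))) := by
    have ha' : Tendsto (fun n => (a n : ℂ)) atTop (𝓝 0) := by
      simpa [Function.comp_def] using (Complex.continuous_ofReal.tendsto 0).comp ha0
    have : Tendsto (fun n => (t : ℂ) * cGrad u j +
        1 / 2 * (a n : ℂ) ^ 2 * (s ⬝ᵥ (cHess u).mulVec s) + D n) atTop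
        (𝓝 ((t : ℂ) * cGrad u j + 1 / 2 * 0 ^ 2 * (s ⬝ᵥ (cHess u).mulVec s) + 0)) :=
      ((tendsto_const_nhds.add (((ha'.pow 2).const_mul _).mul_const _))).add hD
    simpa [Function.comp_def] using (Complex.continuous_exp.tendsto _).comp this
  refine ge_of_tendsto ((Complex.continuous_re.tendsto _).comp hlim) ?_
  filter_upwards [hM, ha] with n hn han
  obtain ⟨ρ, hρ, hρ'⟩ := integral_exp_pairing_nonneg (P := P n) (Ω := Ω n)
    (fun i => (√(φ n))⁻¹ * (a n * (Pi.single j t : Fin m → ℝ) i))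
  have hs : ((√(φ n) : ℝ) : ℂ)⁻¹ • ((a n : ℂ) • s) = fun i =>
      (((√(φ n))⁻¹ * (a n * (Pi.single j t : Fin m → ℝ) i) : ℝ) : ℂ) := by
    ext i
    rcases eq_or_ne i j with rfl | hij
    · simp [s]
    · simp [s, hij]
  rw [hs, hρ'] at hn
  have h1 : √(φ n) * (∑ i, cGrad u i * ((a n : ℂ) • s) i) = t * cGrad u j := by
    rw [Finset.sum_eq_single j (fun i _ hi => by simp [s, hi]) (by simp)]
    have : ((√(φ n) : ℝ) : ℂ) ≠ 0 := by exact_mod_cast han.2.ne'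
    simp only [s, Pi.smul_apply, Pi.single_eq_same, smul_eq_mul, han.1]
    push_cast
    field_simp
  have h2 : 1 / 2 * (((a n : ℂ) • s) ⬝ᵥ (cHess u).mulVec ((a n : ℂ) • s)) =
      1 / 2 * (a n : ℂ) ^ 2 * (s ⬝ᵥ (cHess u).mulVec s) := by
    rw [Matrix.mulVec_smul, smul_dotProduct, dotProduct_smul]
    simp only [smul_eq_mul]
    ring
  rw [h1, h2] at hn
  simp only [Function.comp_apply, ← hn, Complex.ofReal_re]
  exact hρ

/-- Convergence of the moment generating functions of the centred and scaled vectors to that of the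
Gaussian law. -/
lemma HasExpansion.tendsto_mgf (h : HasExpansion u P Ω φ C r) (hC : 0 < C) (hr : 0 < r)
    (hφ : Tendsto φ atTop atTop) (s : Fin m → ℂ) :
    Tendsto (fun n => Complex.exp (-(√(φ n) * (∑ j, cGrad u j * s j))) *
        ∫ ω, Complex.exp (pairing (Ω n ω) (((√(φ n) : ℝ) : ℂ)⁻¹ • s)) ∂(P n)) atTop
      (𝓝 (Complex.exp (1 / 2 * (s ⬝ᵥ (cHess u).mulVec s)))) := by
  obtain ⟨D, hD, hM⟩ := h.exists_error_tendsto_zero hC hr hφ s (a := fun _ => 1) (by simp)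
  have hlim : Tendsto (fun n => Complex.exp (1 / 2 * (s ⬝ᵥ (cHess u).mulVec s) + D n)) atTop
      (𝓝 (Complex.exp (1 / 2 * (s ⬝ᵥ (cHess u).mulVec s)))) := by
    have := (Complex.continuous_exp.tendsto _).comp
      ((tendsto_const_nhds (x := 1 / 2 * (s ⬝ᵥ (cHess u).mulVec s))).add hD)
    simpa [Function.comp_def] using this
  refine hlim.congr' ?_
  filter_upwards [hM] with n hn
  simp only [Complex.ofReal_one, one_smul] at hn
  rw [hn, ← Complex.exp_add]
  congr 1
  ring

/-- The limit `exp (½ yᵀ H y)` of nonnegative numbers is nonnegative for all real `y`, and `y` may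
be scaled. -/
lemma HasExpansion.quadratic_im (h : HasExpansion u P Ω φ C r) (hC : 0 < C) (hr : 0 < r)
    (hφ : Tendsto φ atTop atTop) (y : Fin m → ℝ) :
    ((fun j => (y j : ℂ)) ⬝ᵥ (cHess u).mulVec fun j => (y j : ℂ)).im = 0 := by
  have hG := h.cGrad_im hC hr hφ
  have key : (1 / 2 * ((fun j => (y j : ℂ)) ⬝ᵥ (cHess u).mulVec fun j => (y j : ℂ))).im = 0 := by
    refine im_eq_zero_of_exp_nonneg fun t ht => ?_
    have hlim := h.tendsto_mgf hC hr hφ (((√t : ℝ) : ℂ) • fun j => (y j : ℂ))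
    rw [Matrix.mulVec_smul, smul_dotProduct, dotProduct_smul] at hlim
    have ht2 : 1 / 2 * (((√t : ℝ) : ℂ) • ((√t : ℝ) : ℂ) •
        ((fun j => (y j : ℂ)) ⬝ᵥ (cHess u).mulVec fun j => (y j : ℂ))) =
        t * (1 / 2 * ((fun j => (y j : ℂ)) ⬝ᵥ (cHess u).mulVec fun j => (y j : ℂ))) := by
      have : (t : ℂ) = ((√t : ℝ) : ℂ) * ((√t : ℝ) : ℂ) := by
        rw [← Complex.ofReal_mul, Real.mul_self_sqrt ht]
      rw [this]
      simp only [smul_eq_mul]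
      ring
    rw [ht2] at hlim
    refine ge_of_tendsto ((Complex.continuous_re.tendsto _).comp hlim) (Eventually.of_forall ?_)
    intro n
    obtain ⟨ρ, hρ, hρ'⟩ := integral_exp_pairing_nonneg (P := P n) (Ω := Ω n)
      (fun i => (√(φ n))⁻¹ * (√t * y i))
    have hs : ((√(φ n) : ℝ) : ℂ)⁻¹ • (((√t : ℝ) : ℂ) • fun j => (y j : ℂ)) = fun i =>
        (((√(φ n))⁻¹ * (√t * y i) : ℝ) : ℂ) := by
      ext i; simp
    have hlin : √(φ n) * (∑ j, cGrad u j * (((√t : ℝ) : ℂ) • fun j => (y j : ℂ)) j) =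
        ((√(φ n) * ∑ j, (cGrad u j).re * (√t * y j) : ℝ) : ℂ) := by
      push_cast
      congr 1
      refine Finset.sum_congr rfl fun j _ => ?_
      rw [← Complex.re_add_im (cGrad u j), hG j]
      simp
    rw [Function.comp_apply, hs, hρ', hlin, ← Complex.ofReal_neg, ← Complex.ofReal_exp,
      ← Complex.ofReal_mul, Complex.ofReal_re]
    positivity
  rw [one_div, Complex.mul_im] at key
  simpa using key

/-- Polarisation of `HasExpansion.quadratic_im`. -/
lemma HasExpansion.cHess_im (h : HasExpansion u P Ω φ C r) (hC : 0 < C) (hr : 0 < r)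
    (hφ : Tendsto φ atTop atTop) (hu : AnalyticAt ℂ u 0) (j k : Fin m) :
    (cHess u j k).im = 0 := by
  have hq := h.quadratic_im hC hr hφ
  have cast_single : ∀ i : Fin m, (fun l => (((Pi.single i 1 : Fin m → ℝ) l : ℝ) : ℂ)) =
      Pi.single i 1 := fun i => by
    ext l
    rcases eq_or_ne l i with rfl | hl
    · simp
    · simp [hl]
  have hdiag : ∀ i, (cHess u i i).im = 0 := fun i => by
    have := hq (Pi.single i 1)
    rw [cast_single] at this
    simpa using this
  have h2 := hq (Pi.single j 1 + Pi.single k 1)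
  have hc : (fun l => (((Pi.single j 1 + Pi.single k 1 : Fin m → ℝ) l : ℝ) : ℂ)) =
      Pi.single j 1 + Pi.single k 1 := by
    rw [← cast_single j, ← cast_single k]
    ext l; simp
  rw [hc] at h2
  simp only [Matrix.mulVec_add, add_dotProduct, dotProduct_add, single_one_dotProduct,
    Matrix.mulVec_single_one, Matrix.col_apply, Complex.add_im, hdiag] at h2
  rw [cHess_symm hu k j] at h2
  linarith

lemma HasExpansion.map_ofReal_hess (h : HasExpansion u P Ω φ C r) (hC : 0 < C) (hr : 0 < r)
    (hφ : Tendsto φ atTop atTop) (hu : AnalyticAt ℂ u 0) :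
    (hess u).map Complex.ofReal = cHess u := by
  ext j k
  rw [Matrix.map_apply, hess, Matrix.map_apply]
  exact Complex.ext (by simp) (by simp [h.cHess_im hC hr hφ hu])

lemma HasExpansion.ofReal_grad (h : HasExpansion u P Ω φ C r) (hC : 0 < C) (hr : 0 < r)
    (hφ : Tendsto φ atTop atTop) (j : Fin m) : (grad u j : ℂ) = cGrad u j :=
  Complex.ext (by simp [grad]) (by simp [h.cGrad_im hC hr hφ])

lemma dotProduct_map_ofReal_mulVec (A : Matrix (Fin m) (Fin m) ℝ) (y : Fin m → ℝ) :
    ((fun j => (y j : ℂ)) ⬝ᵥ (A.map Complex.ofReal).mulVec fun j => (y j : ℂ)) =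
      ((y ⬝ᵥ A.mulVec y : ℝ) : ℂ) := by
  simp [dotProduct, Matrix.mulVec]

/-- The modulus of the characteristic functions is at most `1`, so that the limit
`exp (-½ yᵀ H y)` is at most `1` too. -/
lemma HasExpansion.posSemidef_hess [∀ n, IsProbabilityMeasure (P n)]
    (h : HasExpansion u P Ω φ C r) (hC : 0 < C) (hr : 0 < r)
    (hφ : Tendsto φ atTop atTop) (hu : AnalyticAt ℂ u 0) : (hess u).PosSemidef := by
  have hG := h.ofReal_grad hC hr hφ
  refine Matrix.PosSemidef.of_dotProduct_mulVec_nonneg ?_ fun y => ?_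
  · ext j k
    simp [hess, cHess_symm hu j k]
  rw [star_trivial]
  have hlim := h.tendsto_mgf hC hr hφ (Complex.I • fun j => (y j : ℂ))
  rw [Matrix.mulVec_smul, smul_dotProduct, dotProduct_smul, ← h.map_ofReal_hess hC hr hφ hu,
    dotProduct_map_ofReal_mulVec] at hlim
  have hle := le_of_tendsto hlim.norm (b := 1) (Eventually.of_forall fun n => by
    rw [norm_mul]
    have h1 : ‖Complex.exp (-(√(φ n) * ∑ j, cGrad u j * (Complex.I • fun j => (y j : ℂ)) j))‖
        = 1 := by
      have : -(√(φ n) * ∑ j, cGrad u j * (Complex.I • fun j => (y j : ℂ)) j) =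
          ((-(√(φ n) * ∑ j, grad u j * y j) : ℝ) : ℂ) * Complex.I := by
        simp only [← hG]
        push_cast
        rw [neg_mul, mul_assoc, Finset.sum_mul]
        congr 2
        exact Finset.sum_congr rfl fun j _ => by simp; ring
      rw [this, Complex.norm_exp_ofReal_mul_I]
    rw [h1, one_mul]
    refine (norm_integral_le_of_norm_le_const (C := 1) (ae_of_all _ fun ω => ?_)).trans (by simp)
    rw [smul_comm, pairing_smul, ← smul_assoc] at *
    have : ((√(φ n) : ℝ) : ℂ)⁻¹ • (fun j => (y j : ℂ)) = fun j => (((√(φ n))⁻¹ * y j : ℝ) : ℂ) := by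
      ext j; simp
    rw [this, pairing_ofReal, mul_comm, Complex.norm_exp_ofReal_mul_I])
  have hval : 1 / 2 * (Complex.I • Complex.I • ((y ⬝ᵥ (hess u).mulVec y : ℝ) : ℂ)) =
      ((-(1 / 2 * (y ⬝ᵥ (hess u).mulVec y)) : ℝ) : ℂ) := by
    simp only [smul_eq_mul, ← mul_assoc]
    push_cast
    rw [mul_assoc (1 / 2), Complex.I_mul_I]
    ring
  rw [hval, ← Complex.ofReal_exp, Complex.norm_real, Real.norm_eq_abs, Real.abs_exp,
    Real.exp_le_one_iff] at hle
  linarith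

end Consequences

/-! ### Centred multivariate Gaussian measures -/

section Gaussian

variable {m : ℕ} {A : Matrix (Fin m) (Fin m) ℝ}

/-- A centred multivariate Gaussian measure is the image of the product of standard Gaussian
measures under the square root of its covariance matrix. -/
lemma multivariateGaussian_zero_eq_map (A : Matrix (Fin m) (Fin m) ℝ) :
    multivariateGaussian 0 A = (Measure.pi fun _ : Fin m => gaussianReal 0 1).map
      fun x => WithLp.toLp 2 ((CFC.sqrt A).mulVec x) := by
  rw [multivariateGaussian, ← map_pi_eq_stdGaussian, Measure.map_map (by fun_prop) (by fun_prop)]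
  congr 1
  ext x
  simp [Matrix.toEuclideanCLM_toLp]

lemma measurable_toLp_mulVec (R : Matrix (Fin m) (Fin m) ℝ) :
    Measurable fun x : Fin m → ℝ => WithLp.toLp 2 (R.mulVec x) := by
  have : Continuous fun x : Fin m → ℝ => WithLp.toLp 2 (R.mulVec x) :=
    (PiLp.continuous_toLp 2 _).comp (Continuous.matrix_mulVec continuous_const continuous_id)
  exact this.measurable

lemma transpose_sqrt (A : Matrix (Fin m) (Fin m) ℝ) : (CFC.sqrt A).transpose = CFC.sqrt A := by
  have h : IsSelfAdjoint (CFC.sqrt A) := (CFC.sqrt_nonneg A).isSelfAdjoint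
  have h' : (CFC.sqrt A).conjTranspose = CFC.sqrt A := h
  rwa [Matrix.conjTranspose_eq_transpose_of_trivial] at h'

lemma pairing_toLp_mulVec (R : Matrix (Fin m) (Fin m) ℝ) (x : Fin m → ℝ) (s : Fin m → ℂ) :
    pairing (WithLp.toLp 2 (R.mulVec x)) s =
      ∑ k, (R.map Complex.ofReal).transpose.mulVec s k * (x k : ℂ) := by
  simp only [pairing, Matrix.mulVec, dotProduct, Matrix.transpose_apply, Matrix.map_apply,
    Finset.sum_mul]
  rw [Finset.sum_comm]
  push_cast
  simp only [Finset.sum_mul]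
  refine Finset.sum_congr rfl fun k _ => Finset.sum_congr rfl fun j _ => by ring

/-- The moment generating function of a centred multivariate Gaussian at complex arguments. -/
lemma integral_exp_pairing_multivariateGaussian (hA : A.PosSemidef) (s : Fin m → ℂ) :
    ∫ y, Complex.exp (pairing y s) ∂(multivariateGaussian 0 A) =
      Complex.exp (1 / 2 * (s ⬝ᵥ (A.map Complex.ofReal).mulVec s)) := by
  set R := CFC.sqrt A with hR
  have hRR : R * R = A := CFC.sqrt_mul_sqrt_self A hA.nonneg
  set z := (R.map Complex.ofReal).transpose.mulVec s with hz
  rw [multivariateGaussian_zero_eq_map, integral_map (measurable_toLp_mulVec _).aemeasurable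
    (by fun_prop)]
  simp only [← hR, pairing_toLp_mulVec, ← hz, Complex.exp_sum]
  rw [integral_fintype_prod_eq_prod (f := fun k (x : ℝ) => Complex.exp (z k * (x : ℂ)))]
  have h1 : ∀ k, ∫ x : ℝ, Complex.exp (z k * (x : ℂ)) ∂(gaussianReal 0 1) =
      Complex.exp (1 / 2 * (z k * z k)) := by
    intro k
    have := complexMGF_id_gaussianReal (μ := 0) (v := 1) (z k)
    simp only [complexMGF, id] at this
    rw [this]
    congr 1
    simp
    ring
  simp only [h1]
  rw [← Complex.exp_sum, ← Finset.mul_sum]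
  congr 2
  change z ⬝ᵥ z = _
  have hRt : (R.map Complex.ofReal).transpose = R.map Complex.ofReal := by
    rw [← Matrix.transpose_map, hR, transpose_sqrt]
  have hAc : A.map Complex.ofReal = R.map Complex.ofReal * R.map Complex.ofReal := by
    rw [← hRR]
    exact Matrix.map_mul (f := Complex.ofRealHom)
  rw [hz, hRt, hAc, ← Matrix.mulVec_mulVec]
  nth_rewrite 1 [← hRt]
  rw [Matrix.mulVec_transpose, ← Matrix.dotProduct_mulVec]

lemma integrable_exp_pairing_multivariateGaussian (A : Matrix (Fin m) (Fin m) ℝ) (s : Fin m → ℂ) :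
    Integrable (fun y => Complex.exp (pairing y s)) (multivariateGaussian 0 A) := by
  rw [multivariateGaussian_zero_eq_map, integrable_map_measure (by fun_prop)
    (measurable_toLp_mulVec _).aemeasurable]
  simp only [Function.comp_def, pairing_toLp_mulVec, Complex.exp_sum]
  refine Integrable.fintype_prod_dep (f := fun k (x : ℝ) => Complex.exp
    (((CFC.sqrt A).map Complex.ofReal).transpose.mulVec s k * (x : ℂ))) fun k => ?_
  refine (integrable_norm_iff (by fun_prop)).1 ?_
  simp only [Complex.norm_exp, Complex.re_mul_ofReal]
  exact integrable_exp_mul_gaussianReal _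

/-- Slabs between parallel coordinate hyperplanes have Gaussian measure at most proportional to
their width. -/
lemma multivariateGaussian_slab_le (hA : A.PosDef) :
    ∃ L : ℝ, 0 ≤ L ∧ ∀ (j : Fin m) (a b : ℝ), a ≤ b →
      (multivariateGaussian 0 A).real {y | a < y j ∧ y j ≤ b} ≤ L * (b - a) := by
  refine ⟨∑ j, (√(2 * Real.pi * (A j j).toNNReal))⁻¹, by positivity, fun j a b hab => ?_⟩
  have hj : 0 < A j j := hA.diag_pos
  have hmp := measurePreserving_eval_multivariateGaussian (μ := 0) hA.posSemidef (i := j)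
  have h1 : (multivariateGaussian 0 A).real {y | a < y j ∧ y j ≤ b} =
      (gaussianReal 0 (A j j).toNNReal).real (Set.Ioc a b) := by
    have := hmp.measureReal_preimage (s := Set.Ioc a b) measurableSet_Ioc.nullMeasurableSet
    exact this
  have hv : (A j j).toNNReal ≠ 0 := by simpa using hj
  rw [h1, measureReal_def, gaussianReal_apply_eq_integral _ hv, ENNReal.toReal_ofReal
    (integral_nonneg fun x => gaussianPDFReal_nonneg _ _ _)]
  have h2 : ∀ x, gaussianPDFReal 0 (A j j).toNNReal x ≤ (√(2 * Real.pi * (A j j).toNNReal))⁻¹ := by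
    intro x
    rw [gaussianPDFReal]
    refine mul_le_of_le_one_right (by positivity) (Real.exp_le_one_iff.2 ?_)
    rw [neg_div]
    exact neg_nonpos.2 (by positivity)
  calc ∫ x in Set.Ioc a b, gaussianPDFReal 0 (A j j).toNNReal x
      ≤ ∫ x in Set.Ioc a b, (√(2 * Real.pi * (A j j).toNNReal))⁻¹ :=
        setIntegral_mono (integrable_gaussianPDFReal _ _).integrableOn
          (integrableOn_const (by simp)) h2
    _ = (√(2 * Real.pi * (A j j).toNNReal))⁻¹ * (b - a) := by
        rw [setIntegral_const, smul_eq_mul, measureReal_def, Real.volume_Ioc,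
          ENNReal.toReal_ofReal (by linarith), mul_comm]
    _ ≤ _ := by
        refine mul_le_mul_of_nonneg_right ?_ (by linarith)
        exact Finset.single_le_sum (f := fun j => (√(2 * Real.pi * (A j j).toNNReal))⁻¹)
          (fun _ _ => by positivity) (Finset.mem_univ j)

/-- The product of standard Gaussian measures has density `(2π)^{-m/2} exp (-|x|²/2)`. -/
lemma pi_gaussianReal_eq_withDensity :
    (Measure.pi fun _ : Fin m => gaussianReal 0 1) = (volume : Measure (Fin m → ℝ)).withDensity
      fun x => ENNReal.ofReal (((2 * Real.pi) ^ ((m : ℝ) / 2))⁻¹ *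
        Real.exp (-(1 / 2) * (x ⬝ᵥ x))) := by
  have hdens : ∀ x : Fin m → ℝ, ((2 * Real.pi) ^ ((m : ℝ) / 2))⁻¹ *
      Real.exp (-(1 / 2) * (x ⬝ᵥ x)) = ∏ i, gaussianPDFReal 0 1 (x i) := by
    intro x
    simp only [gaussianPDFReal, Finset.prod_mul_distrib, ← Real.exp_sum]
    congr 1
    · simp only [NNReal.coe_one, mul_one, Finset.prod_const, Finset.card_univ, Fintype.card_fin]
      rw [inv_pow, Real.sqrt_eq_rpow, ← Real.rpow_natCast, ← Real.rpow_mul (by positivity)]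
      congr 2
      ring
    · congr 1
      rw [dotProduct, Finset.mul_sum]
      refine Finset.sum_congr rfl fun i _ => ?_
      simp
      ring
  simp only [hdens]
  symm
  refine (Measure.pi_eq fun s hs => ?_).symm
  rw [withDensity_apply _ (MeasurableSet.univ_pi hs)]
  have hint : Integrable (fun x : Fin m → ℝ => ∏ i, gaussianPDFReal 0 1 (x i))
      (Measure.pi fun i => (volume : Measure ℝ).restrict (s i)) :=
    Integrable.fintype_prod_dep (f := fun _ => gaussianPDFReal 0 1) fun i =>
      (integrable_gaussianPDFReal 0 1).restrict
  rw [volume_pi, Measure.restrict_pi_pi, ← ofReal_integral_eq_lintegral_ofReal hint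
    (ae_of_all _ fun x => Finset.prod_nonneg fun i _ => gaussianPDFReal_nonneg _ _ _),
    integral_fintype_prod_eq_prod (f := fun _ => gaussianPDFReal 0 1),
    ENNReal.ofReal_prod_of_nonneg
      fun i _ => integral_nonneg fun x => gaussianPDFReal_nonneg _ _ _]
  refine Finset.prod_congr rfl fun i _ => ?_
  rw [gaussianReal_apply_eq_integral _ one_ne_zero]

/-- The distribution function of a non-degenerate multivariate Gaussian, by the change of
variables `y = √A x`. -/
lemma multivariateGaussian_real_orthant (hA : A.PosDef) (x : Fin m → ℝ) :
    (multivariateGaussian 0 A).real {y | ∀ l, y l ≤ x l} = normalCdf A x := by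
  set R := CFC.sqrt A with hR
  have hRR : R * R = A := CFC.sqrt_mul_sqrt_self A hA.posSemidef.nonneg
  have hRt : R.transpose = R := transpose_sqrt A
  have hdet : R.det * R.det = A.det := by rw [← Matrix.det_mul, hRR]
  have hAdet : 0 < A.det := hA.det_pos
  have hR0 : R.det ≠ 0 := fun h => by rw [h, mul_zero] at hdet; exact hAdet.ne hdet
  have hsqrt : √A.det = |R.det| := by rw [← hdet, Real.sqrt_mul_self_eq_abs]
  have hms : MeasurableSet {y : Fin m → ℝ | ∀ l, y l ≤ x l} := by
    rw [Set.ofPred_forall]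
    exact MeasurableSet.iInter fun l => measurableSet_le (by fun_prop) (by fun_prop)
  have hms' : MeasurableSet {y : EuclideanSpace ℝ (Fin m) | ∀ l, y l ≤ x l} := by
    rw [Set.ofPred_forall]
    exact MeasurableSet.iInter fun l => measurableSet_le (by fun_prop) (by fun_prop)
  have hRm : Measurable fun z : Fin m → ℝ => R.mulVec z := by
    have : Continuous fun z : Fin m → ℝ => R.mulVec z :=
      Continuous.matrix_mulVec continuous_const continuous_id
    exact this.measurable
  have hquad : ∀ z : Fin m → ℝ, R.mulVec z ⬝ᵥ A⁻¹.mulVec (R.mulVec z) = z ⬝ᵥ z := by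
    intro z
    have h1 : R * (A⁻¹ * R) = 1 := by
      rw [← hRR, Matrix.mul_inv_rev, Matrix.mul_assoc, Matrix.nonsing_inv_mul _ hR0.isUnit,
        Matrix.mul_one, Matrix.mul_nonsing_inv _ hR0.isUnit]
    rw [Matrix.mulVec_mulVec]
    nth_rewrite 1 [← hRt]
    rw [Matrix.mulVec_transpose, ← Matrix.dotProduct_mulVec, Matrix.mulVec_mulVec, h1,
      Matrix.one_mulVec]
  rw [multivariateGaussian_zero_eq_map, ← hR, measureReal_def,
    Measure.map_apply (measurable_toLp_mulVec R) hms', pi_gaussianReal_eq_withDensity,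
    withDensity_apply _ (measurable_toLp_mulVec R hms'), ← integral_toReal (by fun_prop)
      (ae_of_all _ fun _ => ENNReal.ofReal_lt_top)]
  have h1 : ∀ z : Fin m → ℝ, (ENNReal.ofReal (((2 * Real.pi) ^ ((m : ℝ) / 2))⁻¹ *
      Real.exp (-(1 / 2) * (z ⬝ᵥ z)))).toReal = ((2 * Real.pi) ^ ((m : ℝ) / 2))⁻¹ *
      Real.exp (-(1 / 2) * (R.mulVec z ⬝ᵥ A⁻¹.mulVec (R.mulVec z))) := fun z => by
    rw [ENNReal.toReal_ofReal (by positivity), hquad]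
  simp only [h1]
  rw [integral_const_mul, normalCdf]
  have hmap := Real.map_matrix_volume_pi_eq_smul_volume_pi hR0
  have h2 : ∫ z in (fun z => WithLp.toLp 2 (R.mulVec z)) ⁻¹'
      {y : EuclideanSpace ℝ (Fin m) | ∀ l, y l ≤ x l},
      Real.exp (-(1 / 2) * (R.mulVec z ⬝ᵥ A⁻¹.mulVec (R.mulVec z))) =
      |R.det|⁻¹ * ∫ y in {y : Fin m → ℝ | ∀ l, y l ≤ x l},
        Real.exp (-(1 / 2) * (y ⬝ᵥ A⁻¹.mulVec y)) := by
    have h3 := setIntegral_map (μ := (volume : Measure (Fin m → ℝ)))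
      (f := fun y : Fin m → ℝ => Real.exp (-(1 / 2) * (y ⬝ᵥ A⁻¹.mulVec y)))
      (g := fun z => R.mulVec z) hms (by
        have : Continuous fun y : Fin m → ℝ => Real.exp (-(1 / 2) * (y ⬝ᵥ A⁻¹.mulVec y)) := by
          fun_prop
        exact this.aestronglyMeasurable) hRm.aemeasurable
    refine h3.symm.trans ?_
    have : (fun z => R.mulVec z) = Matrix.toLin' R := by ext z; simp
    rw [this, hmap, Measure.restrict_smul, integral_smul_measure, ENNReal.toReal_ofReal
      (abs_nonneg _), abs_inv, smul_eq_mul]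
  rw [h2, hsqrt]
  field_simp

end Gaussian

/-! ### Band limited kernels -/

section Kernel

variable (V : Type*) [NormedAddCommGroup V] [InnerProductSpace ℝ V] [FiniteDimensional ℝ V]
  [MeasurableSpace V] [BorelSpace V]

open scoped FourierTransform RealInnerProductSpace Convolution

/-- The squared Fourier transform of an even bump function is nonnegative, rapidly decreasing, and
the Fourier transform of a compactly supported function. -/
lemma exists_band_limited :
    ∃ (K : V → ℝ) (g : V → ℂ) (c : ℝ), Continuous K ∧ (∀ x, 0 ≤ K x) ∧ 0 < ∫ x, K x ∧
      Integrable K ∧ Integrable (fun x => ‖x‖ * K x) ∧ Continuous g ∧ (∀ t, ‖g t‖ ≤ c) ∧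
      (∀ t, 1 < ‖t‖ → g t = 0) ∧
      ∀ x, (K x : ℂ) = ∫ t, g t * Complex.exp (-(2 * Real.pi * ⟪t, x⟫ : ℝ) * Complex.I) := by
  let β : ContDiffBump (0 : V) := ⟨1 / 4, 1 / 2, by norm_num, by norm_num⟩
  let f₀ : V → ℂ := fun x => (β x : ℂ)
  have hf₀s : HasCompactSupport f₀ := β.hasCompactSupport.comp_left (g := Complex.ofReal) (by simp)
  have hβ : ContDiff ℝ (⊤ : ℕ∞) β := β.contDiff
  have hf₀c : ContDiff ℝ (⊤ : ℕ∞) f₀ := Complex.ofRealCLM.contDiff.comp hβ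
  let f : SchwartzMap V ℂ := hf₀s.toSchwartzMap hf₀c
  have hf : ∀ x, f x = (β x : ℂ) := fun x => rfl
  let g : SchwartzMap V ℂ := SchwartzMap.convolution (ContinuousLinearMap.mul ℂ ℂ) f f
  have hFg : ∀ x, 𝓕 g x = 𝓕 f x * 𝓕 f x := fun x => by
    simp [g, SchwartzMap.fourier_convolution]
  have hFreal : ∀ x, (𝓕 f x).im = 0 := by
    intro x
    rw [← Complex.conj_eq_iff_im, SchwartzMap.fourier_coe, Real.fourier_eq', ← integral_conj,
      ← integral_neg_eq_self]
    congr 1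
    ext v
    simp only [smul_eq_mul, map_mul, hf, β.neg, Complex.conj_ofReal, ← Complex.exp_conj,
      Complex.conj_I, inner_neg_left]
    congr 2
    push_cast
    ring
  let K : V → ℝ := fun x => (𝓕 f x).re ^ 2
  have hK : ∀ x, (K x : ℂ) = 𝓕 g x := fun x => by
    rw [hFg]
    apply Complex.ext <;> simp [K, hFreal, sq]
  have hKnorm : ∀ x, ‖𝓕 g x‖ = K x := fun x => by
    rw [← hK, Complex.norm_real, Real.norm_of_nonneg (sq_nonneg _)]
  have hKc : Continuous K := (Complex.continuous_re.comp (𝓕 f).continuous).pow 2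
  have hKi : Integrable K := by
    have := (𝓕 g).integrable (μ := volume).norm
    simpa only [hKnorm] using this
  have hKi1 : Integrable (fun x => ‖x‖ * K x) := by
    have := (𝓕 g).integrable_pow_mul (volume : Measure V) 1
    simpa only [hKnorm, pow_one] using this
  have hK0 : 0 < K 0 := by
    have h1 : 𝓕 f 0 = ((∫ x, β x : ℝ) : ℂ) := by
      rw [SchwartzMap.fourier_coe, Real.fourier_eq']
      simp only [inner_zero_right, hf]
      simp [integral_complex_ofReal]
    have h2 : 0 < ∫ x, β x := β.integral_pos
    simp only [K, h1, Complex.ofReal_re]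
    positivity
  obtain ⟨c, hc⟩ : ∃ c, ∀ x, ‖g x‖ ≤ c := ⟨SchwartzMap.seminorm ℝ 0 0 g,
    fun x => SchwartzMap.norm_le_seminorm ℝ g x⟩
  refine ⟨K, g, c, hKc, fun x => sq_nonneg _, ?_, hKi, hKi1, g.continuous, hc, ?_, ?_⟩
  · exact integral_pos_of_integrable_nonneg_nonzero hKc hKi (fun x => sq_nonneg _) hK0.ne'
  · intro t ht
    rw [SchwartzMap.convolution_apply]
    refine integral_eq_zero_of_ae (ae_of_all _ fun s => ?_)
    simp only [ContinuousLinearMap.mul_apply', hf, Pi.zero_apply, mul_eq_zero,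
      Complex.ofReal_eq_zero]
    by_contra! h
    have h1 : s ∈ Metric.ball (0 : V) (1 / 2) := by
      rw [← β.support_eq]; exact h.1
    have h2 : t - s ∈ Metric.ball (0 : V) (1 / 2) := by
      rw [← β.support_eq]; exact h.2
    rw [mem_ball_zero_iff] at h1 h2
    have := norm_add_le s (t - s)
    rw [add_sub_cancel] at this
    linarith
  · intro x
    rw [hK, SchwartzMap.fourier_coe, Real.fourier_eq']
    congr 1
    ext v
    rw [smul_eq_mul, mul_comm]
    congr 2
    push_cast
    ring

/-- Probability densities with Fourier transform supported in the ball of radius `T` and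
concentrated on the scale `1 / T`. -/
lemma exists_smoothing_kernel :
    ∃ c : ℝ, 0 < c ∧ ∀ T : ℝ, 0 < T → ∃ (K : V → ℝ) (ψ : V → ℂ),
      Continuous K ∧ (∀ x, 0 ≤ K x) ∧ ∫ x, K x = 1 ∧
      Integrable K ∧ Integrable (fun x => ‖x‖ * K x) ∧ ∫ x, ‖x‖ * K x ≤ c / T ∧
      Integrable ψ ∧ (∀ t, ‖ψ t‖ ≤ c) ∧ (∀ t, T < ‖t‖ → ψ t = 0) ∧
      ∀ x, (K x : ℂ) = ∫ t, ψ t * Complex.exp (⟪t, x⟫ * Complex.I) := by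
  obtain ⟨K, g, c, hKc, hK0, hKpos, hKi, hKi1, hgc, hg, hgs, hK⟩ := exists_band_limited V
  set I := ∫ x, K x with hI
  set d := Module.finrank ℝ V with hd
  have hc : 0 ≤ c := (norm_nonneg _).trans (hg 0)
  have hJ : 0 ≤ ∫ x, ‖x‖ * K x := integral_nonneg fun x => mul_nonneg (norm_nonneg _) (hK0 x)
  refine ⟨c * I⁻¹ * ((2 * Real.pi) ^ d)⁻¹ + 2 * Real.pi * I⁻¹ * (∫ x, ‖x‖ * K x) + 1, by positivity,
    fun T hT => ?_⟩
  set a := T / (2 * Real.pi) with ha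
  have ha0 : 0 < a := by positivity
  refine ⟨fun x => I⁻¹ * a ^ d * K (a • x),
    fun t => (I⁻¹ * ((2 * Real.pi) ^ d)⁻¹ : ℝ) * g ((-T)⁻¹ • t), by fun_prop,
    fun x => mul_nonneg (by positivity) (hK0 _), ?_, ?_, ?_, ?_, ?_, ?_, ?_, ?_⟩
  · rw [integral_const_mul, Measure.integral_comp_smul, abs_of_pos (by positivity), smul_eq_mul,
      ← hI, ← hd]
    field_simp
  · exact (hKi.comp_smul ha0.ne').const_mul _
  · refine ((hKi1.comp_smul ha0.ne').const_mul (I⁻¹ * a ^ d * a⁻¹)).congr (ae_of_all _ fun x => ?_)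
    simp only [norm_smul, Real.norm_of_nonneg ha0.le]
    field_simp
  · have : ∀ x, ‖x‖ * (I⁻¹ * a ^ d * K (a • x)) = I⁻¹ * a ^ d * a⁻¹ * (‖a • x‖ * K (a • x)) := by
      intro x
      simp only [norm_smul, Real.norm_of_nonneg ha0.le]
      field_simp
    simp only [this]
    rw [integral_const_mul,
      Measure.integral_comp_smul (μ := (volume : Measure V)) (f := fun x => ‖x‖ * K x),
      abs_of_pos (by positivity), smul_eq_mul]
    have : I⁻¹ * a ^ d * a⁻¹ * ((a ^ d)⁻¹ * ∫ x, ‖x‖ * K x) =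
        2 * Real.pi * I⁻¹ * (∫ x, ‖x‖ * K x) / T := by
      rw [ha]; field_simp
    rw [this]
    gcongr
    have : 0 ≤ c * I⁻¹ * ((2 * Real.pi) ^ d)⁻¹ := by positivity
    linarith
  · have hgi : Integrable g := Continuous.integrable_of_hasCompactSupport hgc
      (HasCompactSupport.intro (isCompact_closedBall (0 : V) 1) fun t ht => hgs t (by
        simpa using ht))
    exact (hgi.comp_smul (by simpa using hT.ne')).const_mul _
  · intro t
    rw [norm_mul, Complex.norm_real, Real.norm_of_nonneg (by positivity)]
    calc I⁻¹ * ((2 * Real.pi) ^ d)⁻¹ * ‖g ((-T)⁻¹ • t)‖ ≤ I⁻¹ * ((2 * Real.pi) ^ d)⁻¹ * c := by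
          gcongr; exact hg _
      _ ≤ _ := by
          have : 0 ≤ 2 * Real.pi * I⁻¹ * (∫ x, ‖x‖ * K x) := by positivity
          linarith
  · intro t ht
    beta_reduce
    rw [hgs, mul_zero]
    rw [norm_smul, norm_inv, norm_neg, Real.norm_of_nonneg hT.le, inv_mul_eq_div, lt_div_iff₀ hT]
    linarith
  · intro x
    have key := Measure.integral_comp_smul (μ := (volume : Measure V)) (fun t => g t *
      Complex.exp (-(2 * Real.pi * ⟪t, a • x⟫ : ℝ) * Complex.I)) (-T)⁻¹
    rw [← hK] at key
    have e : ∀ t, (I⁻¹ * ((2 * Real.pi) ^ d)⁻¹ : ℝ) * g ((-T)⁻¹ • t) *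
        Complex.exp (⟪t, x⟫ * Complex.I) = (I⁻¹ * ((2 * Real.pi) ^ d)⁻¹ : ℝ) * (g ((-T)⁻¹ • t) *
        Complex.exp (-(2 * Real.pi * ⟪(-T)⁻¹ • t, a • x⟫ : ℝ) * Complex.I)) := by
      intro t
      rw [mul_assoc]
      congr 4
      rw [← Complex.ofReal_neg]
      congr 1
      rw [real_inner_smul_left, real_inner_smul_right, ha]
      field_simp
    simp only [e]
    rw [integral_const_mul, key, inv_pow, inv_inv, abs_pow, abs_neg, abs_of_pos hT, ← hd,
      Complex.real_smul, ha, div_pow]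
    push_cast
    ring

end Kernel

/-! ### Distribution functions and exponential weights -/

section Smoothing

variable {m : ℕ}

/-- The distribution function of a measure on `ℝ^m`. -/
def orthantCdf (μ : Measure (EuclideanSpace ℝ (Fin m))) (x : Fin m → ℝ) : ℝ :=
  μ.real {y | ∀ l, y l ≤ x l}

lemma measurableSet_orthant (x : Fin m → ℝ) :
    MeasurableSet {y : EuclideanSpace ℝ (Fin m) | ∀ l, y l ≤ x l} := by
  rw [Set.ofPred_forall]
  exact MeasurableSet.iInter fun l => measurableSet_le (by fun_prop) (by fun_prop)

lemma orthantCdf_mono (μ : Measure (EuclideanSpace ℝ (Fin m))) [IsFiniteMeasure μ] :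
    Monotone (orthantCdf μ) := fun _ _ h =>
  measureReal_mono fun _ hy l => (hy l).trans (h l)

lemma orthantCdf_nonneg (μ : Measure (EuclideanSpace ℝ (Fin m))) (x : Fin m → ℝ) :
    0 ≤ orthantCdf μ x := measureReal_nonneg

lemma orthantCdf_le_one (μ : Measure (EuclideanSpace ℝ (Fin m))) [IsProbabilityMeasure μ]
    (x : Fin m → ℝ) : orthantCdf μ x ≤ 1 := measureReal_le_one

/-- A distribution function whose measure gives little mass to slabs is Lipschitz. -/
lemma orthantCdf_lipschitz (μ : Measure (EuclideanSpace ℝ (Fin m))) [IsFiniteMeasure μ] {L : ℝ}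
    (hL : 0 ≤ L) (h : ∀ (j : Fin m) (a b : ℝ), a ≤ b → μ.real {y | a < y j ∧ y j ≤ b} ≤ L * (b - a))
    (x y : Fin m → ℝ) : |orthantCdf μ x - orthantCdf μ y| ≤ m * L * ‖x - y‖ := by
  have key : orthantCdf μ (x ⊔ y) - orthantCdf μ (x ⊓ y) ≤ m * L * ‖x - y‖ := by
    have hsub : {z : EuclideanSpace ℝ (Fin m) | ∀ l, z l ≤ (x ⊔ y) l} ⊆
        {z | ∀ l, z l ≤ (x ⊓ y) l} ∪ ⋃ j, {z | (x ⊓ y) j < z j ∧ z j ≤ (x ⊔ y) j} := by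
      intro z hz
      by_cases hz' : ∀ l, z l ≤ (x ⊓ y) l
      · exact Or.inl hz'
      · push Not at hz'
        obtain ⟨j, hj⟩ := hz'
        exact Or.inr (Set.mem_iUnion.2 ⟨j, hj, hz j⟩)
    have h1 := (measureReal_mono (μ := μ) hsub).trans (measureReal_union_le _ _)
    have h2 := measureReal_iUnion_fintype_le (μ := μ)
      fun j => {z : EuclideanSpace ℝ (Fin m) | (x ⊓ y) j < z j ∧ z j ≤ (x ⊔ y) j}
    have h3 : ∑ j, μ.real {z : EuclideanSpace ℝ (Fin m) | (x ⊓ y) j < z j ∧ z j ≤ (x ⊔ y) j} ≤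
        ∑ _j : Fin m, L * ‖x - y‖ := by
      refine Finset.sum_le_sum fun j _ => (h j _ _ (by simp)).trans ?_
      refine mul_le_mul_of_nonneg_left ?_ hL
      rw [Pi.sup_apply, Pi.inf_apply, sup_sub_inf_eq_abs_sub]
      rw [abs_sub_comm]
      exact norm_le_pi_norm (x - y) j
    simp only [Finset.sum_const, Finset.card_univ, Fintype.card_fin, nsmul_eq_mul] at h3
    unfold orthantCdf
    linarith
  have h1 := orthantCdf_mono μ (le_sup_left : x ≤ x ⊔ y)
  have h2 := orthantCdf_mono μ (le_sup_right : y ≤ x ⊔ y)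
  have h3 := orthantCdf_mono μ (inf_le_left : x ⊓ y ≤ x)
  have h4 := orthantCdf_mono μ (inf_le_right : x ⊓ y ≤ y)
  rw [abs_le]
  constructor <;> linarith

/-- Removal of a smoothing: if the smoothings of a monotone function `F` and a Lipschitz function
`G` with values in `[0, 1]` are uniformly close, then so are `F` and `G`. At a point where `F - G`
is nearly extremal, monotonicity keeps it so on a shifted ball that carries most of the mass of the
kernel. -/
lemma abs_sub_le_of_smoothed {F G : (Fin m → ℝ) → ℝ} (hF : Monotone F)
    (hF0 : ∀ x, 0 ≤ F x) (hF1 : ∀ x, F x ≤ 1) (hG0 : ∀ x, 0 ≤ G x) (hG1 : ∀ x, G x ≤ 1)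
    {L : ℝ} (hG : ∀ x y, |G x - G y| ≤ L * ‖x - y‖) (hL : 0 ≤ L)
    {K : EuclideanSpace ℝ (Fin m) → ℝ} (hK0 : ∀ z, 0 ≤ K z) (hK1 : ∫ z, K z = 1)
    (hKi : Integrable K) (hKi1 : Integrable fun z => ‖z‖ * K z) {c : ℝ} (hc : 0 < c)
    (hKc : ∫ z, ‖z‖ * K z ≤ c)
    (hint : ∀ x, Integrable fun z => K z * (F (x + z.ofLp) - G (x + z.ofLp)))
    {η : ℝ} (h : ∀ x, |∫ z, K z * (F (x + z.ofLp) - G (x + z.ofLp))| ≤ η) (x : Fin m → ℝ) :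
    |F x - G x| ≤ 2 * η + 16 * c * L := by
  have hbdd : BddAbove (Set.range fun x => |F x - G x|) := by
    refine ⟨1, ?_⟩
    rintro _ ⟨x, rfl⟩
    change |F x - G x| ≤ 1
    rw [abs_le]
    constructor <;> linarith [hF0 x, hF1 x, hG0 x, hG1 x]
  set Δ := ⨆ x, |F x - G x| with hΔ
  have hle : ∀ x, |F x - G x| ≤ Δ := fun x => le_ciSup hbdd x
  have hΔ0 : 0 ≤ Δ := (abs_nonneg _).trans (hle x)
  have hcoord : ∀ (z : EuclideanSpace ℝ (Fin m)) l, |z l| ≤ ‖z‖ := fun z l => by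
    simpa using PiLp.norm_apply_le z l
  -- the radius of the ball that contains three quarters of the mass of `K`
  set a := 4 * c with ha
  have hshift : ∀ (z : EuclideanSpace ℝ (Fin m)) (ε : ℝ), |ε| = a → ‖z‖ ≤ a → ∀ x : Fin m → ℝ,
      |G (x + (fun _ => ε) + z.ofLp) - G x| ≤ 2 * a * L := by
    intro z ε hε hz x
    refine (hG _ _).trans ?_
    rw [mul_comm]
    refine mul_le_mul_of_nonneg_right ?_ hL
    refine (pi_norm_le_iff_of_nonneg (by positivity)).2 fun l => ?_
    have : (x + (fun _ => ε) + z.ofLp - x : Fin m → ℝ) l = ε + z l := by simp; ring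
    rw [this, Real.norm_eq_abs]
    refine (abs_add_le _ _).trans ?_
    have := hcoord z l
    linarith
  have hmain : ∀ d : ℝ, ∫ z, K z * (d - 2 * Δ / a * ‖z‖) = d - 2 * Δ / a * ∫ z, ‖z‖ * K z := by
    intro d
    have : ∀ z, K z * (d - 2 * Δ / a * ‖z‖) = d * K z - 2 * Δ / a * (‖z‖ * K z) := fun z => by ring
    simp only [this]
    rw [integral_sub (hKi.const_mul _) (hKi1.const_mul _), integral_const_mul, integral_const_mul,
      hK1, mul_one]
  have hmaini : ∀ d : ℝ, Integrable fun z => K z * (d - 2 * Δ / a * ‖z‖) := by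
    intro d
    have : ∀ z, K z * (d - 2 * Δ / a * ‖z‖) = d * K z - 2 * Δ / a * (‖z‖ * K z) := fun z => by ring
    simp only [this]
    exact (hKi.const_mul _).sub (hKi1.const_mul _)
  have hhalf : 2 * Δ / a * ∫ z, ‖z‖ * K z ≤ Δ / 2 := by
    calc 2 * Δ / a * ∫ z, ‖z‖ * K z ≤ 2 * Δ / a * c := by gcongr
      _ = Δ / 2 := by rw [ha]; field_simp; ring
  -- outside the ball the trivial bound `Δ` is affordable, as `2 Δ ‖z‖ / a ≥ 2 Δ` there
  have htail : ∀ z : EuclideanSpace ℝ (Fin m), ¬ ‖z‖ ≤ a → 2 * Δ ≤ 2 * Δ / a * ‖z‖ := by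
    intro z hz
    rw [div_mul_eq_mul_div, le_div_iff₀ (by positivity)]
    exact mul_le_mul_of_nonneg_left (not_le.1 hz).le (by positivity)
  have hnn : ∀ z : EuclideanSpace ℝ (Fin m), 0 ≤ 2 * Δ / a * ‖z‖ := fun z => by positivity
  have hone : ∀ x, |F x - G x| ≤ η + 2 * a * L + Δ / 2 := by
    intro x
    have hx := abs_le.1 (hle x)
    rw [abs_le]
    constructor
    · have h1 := h (x + fun _ => -a)
      have h2 : ∫ z, K z * ((G x - F x - 2 * a * L) - 2 * Δ / a * ‖z‖) ≤
          ∫ z, -(K z * (F (x + (fun _ => -a) + z.ofLp) - G (x + (fun _ => -a) + z.ofLp))) := by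
        refine integral_mono (hmaini _) (hint _).neg fun z => ?_
        change _ ≤ -(K z * _)
        rw [← mul_neg]
        refine mul_le_mul_of_nonneg_left ?_ (hK0 z)
        by_cases hz : ‖z‖ ≤ a
        · have h3 := abs_le.1 (hshift z (-a) (by rw [abs_neg, abs_of_pos (by positivity)]) hz x)
          have h4 : F (x + (fun _ => -a) + z.ofLp) ≤ F x := hF fun l => by
            have := (abs_le.1 (hcoord z l)).2
            simp only [Pi.add_apply]
            linarith
          have := hnn z
          linarith
        · have h3 := abs_le.1 (hle (x + (fun _ => -a) + z.ofLp))
          have := htail z hz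
          have : 0 ≤ a * L := by positivity
          linarith
      rw [hmain, integral_neg] at h2
      have := (abs_le.1 h1).1
      linarith
    · have h1 := h (x + fun _ => a)
      have h2 : ∫ z, K z * ((F x - G x - 2 * a * L) - 2 * Δ / a * ‖z‖) ≤
          ∫ z, K z * (F (x + (fun _ => a) + z.ofLp) - G (x + (fun _ => a) + z.ofLp)) := by
        refine integral_mono (hmaini _) (hint _) fun z => ?_
        refine mul_le_mul_of_nonneg_left ?_ (hK0 z)
        by_cases hz : ‖z‖ ≤ a
        · have h3 := abs_le.1 (hshift z a (abs_of_pos (by positivity)) hz x)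
          have h4 : F x ≤ F (x + (fun _ => a) + z.ofLp) := hF fun l => by
            have := (abs_le.1 (hcoord z l)).1
            simp only [Pi.add_apply]
            linarith
          have := hnn z
          linarith
        · have h3 := abs_le.1 (hle (x + (fun _ => a) + z.ofLp))
          have := htail z hz
          have : 0 ≤ a * L := by positivity
          linarith
      rw [hmain] at h2
      have := (abs_le.1 h1).2
      linarith
  have hsup : Δ ≤ η + 2 * a * L + Δ / 2 := ciSup_le hone
  have := hle x
  have : 2 * a * L = 8 * c * L := by rw [ha]; ring
  linarith

variable {ι : Type*} [Fintype ι]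

/-- A weight that grows exponentially and whose product with a measure has a Fourier transform
expressed by values of the moment generating function of the measure. -/
def expWeight (σ : ι → EuclideanSpace ℝ (Fin m)) (y : EuclideanSpace ℝ (Fin m)) : ℝ :=
  ∑ i, Real.exp ⟪σ i, y⟫

@[fun_prop]
lemma continuous_expWeight (σ : ι → EuclideanSpace ℝ (Fin m)) : Continuous (expWeight σ) := by
  unfold expWeight; fun_prop

lemma expWeight_le_exp_mul {σ : ι → EuclideanSpace ℝ (Fin m)} (hσ : ∀ i, ‖σ i‖ ≤ 1)
    (p q : EuclideanSpace ℝ (Fin m)) :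
    expWeight σ p ≤ Real.exp ‖p - q‖ * expWeight σ q := by
  rw [expWeight, expWeight, Finset.mul_sum]
  refine Finset.sum_le_sum fun i _ => ?_
  rw [← Real.exp_add]
  refine Real.exp_le_exp.2 ?_
  have h1 : ⟪σ i, p⟫ = ⟪σ i, p - q⟫ + ⟪σ i, q⟫ := by rw [← inner_add_right, sub_add_cancel]
  have h2 := real_inner_le_norm (σ i) (p - q)
  have h3 : ‖σ i‖ * ‖p - q‖ ≤ ‖p - q‖ := mul_le_of_le_one_left (norm_nonneg _) (hσ i)
  linarith

lemma inv_expWeight_sub_le {σ : ι → EuclideanSpace ℝ (Fin m)} (hσ : ∀ i, ‖σ i‖ ≤ 1)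
    (hw : ∀ y, 1 ≤ expWeight σ y) (p q : EuclideanSpace ℝ (Fin m)) :
    |(expWeight σ p)⁻¹ - (expWeight σ q)⁻¹| ≤ ‖p - q‖ := by
  have one_side : ∀ p q, (expWeight σ p)⁻¹ - (expWeight σ q)⁻¹ ≤ ‖p - q‖ := by
    intro p q
    have hp : 0 < expWeight σ p := by linarith [hw p]
    have hq : 0 < expWeight σ q := by linarith [hw q]
    have h1 : Real.exp (-‖q - p‖) * (expWeight σ p)⁻¹ ≤ (expWeight σ q)⁻¹ := by
      rw [Real.exp_neg, ← mul_inv]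
      exact inv_anti₀ hq (expWeight_le_exp_mul hσ q p)
    have h2 : 1 - ‖q - p‖ ≤ Real.exp (-‖q - p‖) := by
      linarith [Real.add_one_le_exp (-‖q - p‖)]
    have h3 : (expWeight σ p)⁻¹ ≤ 1 := inv_le_one_of_one_le₀ (hw p)
    have h4 : 0 < (expWeight σ p)⁻¹ := inv_pos.2 hp
    rw [norm_sub_rev]
    nlinarith [norm_nonneg (q - p)]
  rw [abs_sub_le_iff]
  exact ⟨one_side p q, by rw [norm_sub_rev]; exact one_side q p⟩

end Smoothing

/-! ### The smoothing inequality -/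

section Smoothing

variable {m : ℕ} {ι : Type*} [Fintype ι]

/-- The Fourier transform of the weighted measure `expWeight σ • μ`. -/
def weightedCharFun (σ : ι → EuclideanSpace ℝ (Fin m)) (μ : Measure (EuclideanSpace ℝ (Fin m)))
    (t : EuclideanSpace ℝ (Fin m)) : ℂ :=
  ∫ y, (expWeight σ y : ℂ) * Complex.exp (⟪t, y⟫ * Complex.I) ∂μ

section Kernel

variable {σ : ι → EuclideanSpace ℝ (Fin m)} {μ : Measure (EuclideanSpace ℝ (Fin m))}
  {K : EuclideanSpace ℝ (Fin m) → ℝ} {ψ : EuclideanSpace ℝ (Fin m) → ℂ}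

/-- The density of the smoothing of `expWeight σ • μ` by a band limited kernel, as an inverse
Fourier transform. -/
lemma ofReal_integral_expWeight_mul_kernel [IsFiniteMeasure μ] (hμ : Integrable (expWeight σ) μ)
    (hψ : Integrable ψ) (hK : ∀ x, (K x : ℂ) = ∫ t, ψ t * Complex.exp (⟪t, x⟫ * Complex.I))
    (q : EuclideanSpace ℝ (Fin m)) :
    ((∫ y, expWeight σ y * K (y - q) ∂μ : ℝ) : ℂ) =
      ∫ t, ψ t * Complex.exp (-⟪t, q⟫ * Complex.I) * weightedCharFun σ μ t := by
  have h1 : Integrable (fun p : EuclideanSpace ℝ (Fin m) × EuclideanSpace ℝ (Fin m) =>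
      (expWeight σ p.1 : ℂ) * ψ p.2 * Complex.exp (⟪p.2, p.1 - q⟫ * Complex.I))
      (μ.prod volume) := by
    refine (hμ.ofReal.mul_prod hψ).mul_bdd (c := 1) ?_ (ae_of_all _ fun p => ?_)
    · exact Continuous.aestronglyMeasurable (by fun_prop)
    · rw [Complex.norm_exp_ofReal_mul_I]
  calc ((∫ y, expWeight σ y * K (y - q) ∂μ : ℝ) : ℂ)
      = ∫ y, (∫ t, (expWeight σ y : ℂ) * ψ t * Complex.exp (⟪t, y - q⟫ * Complex.I)) ∂μ := by
        rw [← integral_complex_ofReal]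
        congr 1
        ext y
        push_cast
        rw [hK, ← integral_const_mul]
        simp only [mul_assoc]
    _ = ∫ t, ∫ y, (expWeight σ y : ℂ) * ψ t * Complex.exp (⟪t, y - q⟫ * Complex.I) ∂μ :=
        integral_integral_swap (f := fun y t => (expWeight σ y : ℂ) * ψ t *
          Complex.exp (⟪t, y - q⟫ * Complex.I)) h1
    _ = _ := by
        congr 1
        ext t
        rw [weightedCharFun, ← integral_const_mul]
        congr 1
        ext y
        rw [inner_sub_right]
        push_cast
        rw [sub_mul, sub_eq_add_neg, Complex.exp_add, neg_mul]
        ring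

lemma integrable_mul_weightedCharFun [IsFiniteMeasure μ] (hμ : Integrable (expWeight σ) μ)
    (hψ : Integrable ψ) (q : EuclideanSpace ℝ (Fin m)) :
    Integrable fun t => ψ t * Complex.exp (-⟪t, q⟫ * Complex.I) * weightedCharFun σ μ t := by
  have h1 : Integrable (fun p : EuclideanSpace ℝ (Fin m) × EuclideanSpace ℝ (Fin m) =>
      ψ p.1 * (expWeight σ p.2 : ℂ) * (Complex.exp (-⟪p.1, q⟫ * Complex.I) *
        Complex.exp (⟪p.1, p.2⟫ * Complex.I))) (volume.prod μ) := by
    refine (hψ.mul_prod hμ.ofReal).mul_bdd (c := 1) ?_ (ae_of_all _ fun p => ?_)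
    · exact Continuous.aestronglyMeasurable (by fun_prop)
    · rw [norm_mul, Complex.norm_exp_ofReal_mul_I, ← Complex.ofReal_neg,
        Complex.norm_exp_ofReal_mul_I, mul_one]
  refine h1.integral_prod_left.congr (ae_of_all _ fun t => ?_)
  simp only [weightedCharFun]
  rw [← integral_const_mul]
  congr 1
  ext y
  ring

lemma abs_integral_expWeight_mul_kernel_sub_le {γ : Measure (EuclideanSpace ℝ (Fin m))}
    [IsFiniteMeasure μ] [IsFiniteMeasure γ] (hμ : Integrable (expWeight σ) μ)
    (hγ : Integrable (expWeight σ) γ) (hψ : Integrable ψ)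
    (hK : ∀ x, (K x : ℂ) = ∫ t, ψ t * Complex.exp (⟪t, x⟫ * Complex.I))
    {c T ε : ℝ} (hψc : ∀ t, ‖ψ t‖ ≤ c) (hψT : ∀ t, T < ‖t‖ → ψ t = 0)
    {B : EuclideanSpace ℝ (Fin m) → ℝ} (hB : Integrable B) (hB0 : ∀ t, 0 ≤ B t) (hε : 0 ≤ ε)
    (h : ∀ t, ‖t‖ ≤ T → ‖weightedCharFun σ μ t - weightedCharFun σ γ t‖ ≤ ε * B t)
    (q : EuclideanSpace ℝ (Fin m)) :
    |(∫ y, expWeight σ y * K (y - q) ∂μ) - ∫ y, expWeight σ y * K (y - q) ∂γ| ≤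
      c * ε * ∫ t, B t := by
  have h1 := ofReal_integral_expWeight_mul_kernel hμ hψ hK q
  have h2 := ofReal_integral_expWeight_mul_kernel hγ hψ hK q
  have hc : 0 ≤ c := (norm_nonneg _).trans (hψc 0)
  rw [← Real.norm_eq_abs, ← Complex.norm_real, Complex.ofReal_sub, h1, h2,
    ← integral_sub (integrable_mul_weightedCharFun hμ hψ q)
      (integrable_mul_weightedCharFun hγ hψ q), ← integral_const_mul]
  refine norm_integral_le_of_norm_le (hB.const_mul _) (ae_of_all _ fun t => ?_)
  rw [← mul_sub, norm_mul, norm_mul, ← Complex.ofReal_neg, Complex.norm_exp_ofReal_mul_I, mul_one,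
    mul_assoc]
  by_cases ht : ‖t‖ ≤ T
  · exact mul_le_mul (hψc t) (h t ht) (norm_nonneg _) hc
  · rw [hψT t (not_le.1 ht), norm_zero, zero_mul]
    have := hB0 t
    positivity

/-- Smoothing the indicator of an orthant, in two ways: directly, or after multiplication by the
integrable function `1 / expWeight σ`. As `1 / expWeight σ` is Lipschitz, the results differ by the
scale of the kernel. -/
lemma abs_weighted_sub_smoothed_le [IsProbabilityMeasure μ]
    (hσ : ∀ i, ‖σ i‖ ≤ 1) (hw : ∀ y, 1 ≤ expWeight σ y)
    (hμ : Integrable (expWeight σ) μ)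
    (hKc : Continuous K) (hK0 : ∀ x, 0 ≤ K x) (hKi : Integrable K)
    (hKi1 : Integrable fun x => ‖x‖ * K x) {O : Set (EuclideanSpace ℝ (Fin m))}
    (hO : MeasurableSet O) :
    |(∫ y, expWeight σ y * (∫ q, K (y - q) * O.indicator (fun q => (expWeight σ q)⁻¹) q) ∂μ) -
      ∫ y, (∫ q, K (y - q) * O.indicator 1 q) ∂μ| ≤
      (∫ y, expWeight σ y ∂μ) * ∫ x, ‖x‖ * K x := by
  have hKt : ∀ y, Integrable fun q => K (y - q) := fun y => hKi.comp_sub_left y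
  have hb1 : ∀ q, ‖O.indicator (fun q => (expWeight σ q)⁻¹) q‖ ≤ 1 := fun q => by
    have h1 := hw q
    by_cases hq : q ∈ O
    · rw [Set.indicator_of_mem hq, Real.norm_of_nonneg (by positivity)]
      exact inv_le_one_of_one_le₀ h1
    · simp [hq]
  have hb2 : ∀ q, ‖O.indicator (1 : EuclideanSpace ℝ (Fin m) → ℝ) q‖ ≤ 1 := fun q => by
    by_cases hq : q ∈ O <;> simp [hq]
  have hbm1 : Measurable (O.indicator fun q => (expWeight σ q)⁻¹) :=
    ((continuous_expWeight σ).measurable.inv).indicator hO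
  have hbm2 : Measurable (O.indicator (1 : EuclideanSpace ℝ (Fin m) → ℝ)) :=
    measurable_one.indicator hO
  have hi1 : ∀ y, Integrable fun q => K (y - q) * O.indicator (fun q => (expWeight σ q)⁻¹) q :=
    fun y => (hKt y).mul_bdd (c := 1) hbm1.aestronglyMeasurable (ae_of_all _ hb1)
  have hi2 : ∀ y, Integrable fun q => K (y - q) * O.indicator 1 q :=
    fun y => (hKt y).mul_bdd (c := 1) hbm2.aestronglyMeasurable (ae_of_all _ hb2)
  have hnorm : ∀ {g : EuclideanSpace ℝ (Fin m) → ℝ}, (∀ q, ‖g q‖ ≤ 1) → ∀ y,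
      ‖∫ q, K (y - q) * g q‖ ≤ ∫ x, K x := by
    intro g hg y
    rw [← integral_sub_left_eq_self K volume y]
    refine norm_integral_le_of_norm_le (hKt y) (ae_of_all _ fun q => ?_)
    rw [norm_mul, Real.norm_of_nonneg (hK0 _)]
    exact mul_le_of_le_one_right (hK0 _) (hg q)
  have hmeas : ∀ {g : EuclideanSpace ℝ (Fin m) → ℝ}, Measurable g →
      AEStronglyMeasurable (fun y => ∫ q, K (y - q) * g q) μ := by
    intro g hg
    refine (StronglyMeasurable.integral_prod_right (f := fun y q => K (y - q) * g q)
      (Measurable.stronglyMeasurable ?_)).aestronglyMeasurable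
    exact (by fun_prop : Continuous fun p : EuclideanSpace ℝ (Fin m) × EuclideanSpace ℝ (Fin m) =>
      K (p.1 - p.2)).measurable.mul (hg.comp measurable_snd)
  have hI1 : Integrable (fun y => expWeight σ y * ∫ q, K (y - q) *
      O.indicator (fun q => (expWeight σ q)⁻¹) q) μ :=
    hμ.mul_bdd (hmeas hbm1) (ae_of_all _ (hnorm hb1))
  have hI2 : Integrable (fun y => ∫ q, K (y - q) * O.indicator 1 q) μ :=
    (integrable_const _).mono' (hmeas hbm2) (ae_of_all _ (hnorm hb2))
  rw [← integral_sub hI1 hI2, ← Real.norm_eq_abs, ← integral_mul_const]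
  refine norm_integral_le_of_norm_le (hμ.mul_const _) (ae_of_all _ fun y => ?_)
  have hwy := hw y
  rw [← integral_const_mul, ← integral_sub ((hi1 y).const_mul _) (hi2 y), ← integral_const_mul,
    ← integral_sub_left_eq_self (fun x => expWeight σ y * (‖x‖ * K x)) volume y]
  refine norm_integral_le_of_norm_le ((hKi1.comp_sub_left y).const_mul _)
    (ae_of_all _ fun q => ?_)
  have hwq := hw q
  by_cases hq : q ∈ O
  · have e : expWeight σ y * (K (y - q) * O.indicator (fun q => (expWeight σ q)⁻¹) q) -
        K (y - q) * O.indicator 1 q =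
        expWeight σ y * (((expWeight σ q)⁻¹ - (expWeight σ y)⁻¹) * K (y - q)) := by
      rw [Set.indicator_of_mem hq, Set.indicator_of_mem hq, Pi.one_apply]
      field_simp
    rw [e, norm_mul, norm_mul, Real.norm_of_nonneg (by linarith), Real.norm_of_nonneg (hK0 _),
      Real.norm_eq_abs, norm_sub_rev]
    have := inv_expWeight_sub_le hσ hw q y
    have := hK0 (y - q)
    gcongr
  · have := hK0 (y - q)
    simp only [Set.indicator_of_notMem hq, mul_zero, sub_zero, norm_zero]
    positivity

lemma weighted_eq_integral_density [IsProbabilityMeasure μ]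
    (hμ : Integrable (expWeight σ) μ) (hKc : Continuous K) {M : ℝ} (hKM : ∀ x, ‖K x‖ ≤ M)
    {b : EuclideanSpace ℝ (Fin m) → ℝ} (hb : Integrable b) :
    Integrable (fun q => b q * ∫ y, expWeight σ y * K (y - q) ∂μ) ∧
    ∫ y, expWeight σ y * (∫ q, K (y - q) * b q) ∂μ =
      ∫ q, b q * ∫ y, expWeight σ y * K (y - q) ∂μ := by
  have h1 : Integrable (fun p : EuclideanSpace ℝ (Fin m) × EuclideanSpace ℝ (Fin m) =>
      expWeight σ p.1 * b p.2 * K (p.1 - p.2)) (μ.prod volume) :=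
    (hμ.mul_prod hb).mul_bdd (Continuous.aestronglyMeasurable (by fun_prop))
      (ae_of_all _ fun p => hKM _)
  have e : ∀ q, b q * ∫ y, expWeight σ y * K (y - q) ∂μ =
      ∫ y, expWeight σ y * b q * K (y - q) ∂μ := fun q => by
    rw [← integral_const_mul]
    congr 1; ext y; ring
  simp only [e]
  refine ⟨h1.integral_prod_right, ?_⟩
  rw [← integral_integral_swap (f := fun y q => expWeight σ y * b q * K (y - q)) h1]
  congr 1; ext y
  rw [← integral_const_mul]
  congr 1; ext q; ring

/-- The smoothed measure of an orthant is the convolution of the distribution function with the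
kernel. -/
lemma integral_smoothed_orthant [IsProbabilityMeasure μ] (hKi : Integrable K) (x : Fin m → ℝ) :
    Integrable (fun z => K z * orthantCdf μ (x + z.ofLp)) ∧
    ∫ y, (∫ q, K (y - q) * {q : EuclideanSpace ℝ (Fin m) | ∀ l, q l ≤ x l}.indicator 1 q) ∂μ =
      ∫ z, K z * orthantCdf μ (x + z.ofLp) := by
  set O := {q : EuclideanSpace ℝ (Fin m) | ∀ l, q l ≤ x l} with hO
  have hOm : MeasurableSet O := measurableSet_orthant x
  have h1 : Integrable (fun p : EuclideanSpace ℝ (Fin m) × EuclideanSpace ℝ (Fin m) =>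
      K p.2 * O.indicator 1 (p.1 - p.2)) (μ.prod volume) := by
    refine (hKi.comp_snd μ).mul_bdd (c := 1) ?_ (ae_of_all _ fun p => ?_)
    · exact ((measurable_one.indicator hOm).comp (measurable_fst.sub
        measurable_snd)).aestronglyMeasurable
    · by_cases hq : p.1 - p.2 ∈ O <;> simp [hq]
  have e : ∀ z : EuclideanSpace ℝ (Fin m), ∫ y, K z * O.indicator 1 (y - z) ∂μ =
      K z * orthantCdf μ (x + z.ofLp) := by
    intro z
    rw [integral_const_mul]
    congr 1
    have : ∀ y, O.indicator (1 : EuclideanSpace ℝ (Fin m) → ℝ) (y - z) =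
        {y : EuclideanSpace ℝ (Fin m) | ∀ l, y l ≤ (x + z.ofLp) l}.indicator 1 y := by
      intro y
      simp only [Set.indicator_apply, hO, Set.mem_ofPred_eq, PiLp.sub_apply, Pi.add_apply,
        Pi.one_apply, sub_le_iff_le_add]
    simp only [this]
    rw [integral_indicator_one (measurableSet_orthant _), orthantCdf]
  have h2 := h1.integral_prod_right
  simp only [e] at h2
  refine ⟨h2, ?_⟩
  have h3 := integral_integral_swap (f := fun y z => K z * O.indicator 1 (y - z)) h1
  simp only [e] at h3
  rw [← h3]
  congr 1; ext y
  rw [← integral_sub_left_eq_self (fun z => K z * O.indicator 1 (y - z)) volume y]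
  simp only [sub_sub_cancel]

end Kernel

/-- A smoothing inequality for distribution functions on `ℝ^m`, for a pair of measures with
exponential moments. In contrast to the classical inequalities the difference of the Fourier
transforms is not divided by the product of the coordinates, because the Fourier transforms of
exponentially weighted measures are compared, and the indicator of an orthant is integrable after
division by the weight. -/
theorem exists_smoothing_inequality (σ : ι → EuclideanSpace ℝ (Fin m)) (hσ : ∀ i, ‖σ i‖ ≤ 1)
    (hw : ∀ y, 1 ≤ expWeight σ y) (hwi : Integrable fun y => (expWeight σ y)⁻¹) :
    ∃ c : ℝ, 0 < c ∧ ∀ (μ γ : Measure (EuclideanSpace ℝ (Fin m))) [IsProbabilityMeasure μ]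
      [IsProbabilityMeasure γ] (T ε A L : ℝ) (B : EuclideanSpace ℝ (Fin m) → ℝ), 0 < T → 0 ≤ ε →
      0 ≤ L → Integrable (expWeight σ) μ → Integrable (expWeight σ) γ →
      ∫ y, expWeight σ y ∂μ ≤ A → ∫ y, expWeight σ y ∂γ ≤ A →
      Integrable B → (∀ t, 0 ≤ B t) →
      (∀ t, ‖t‖ ≤ T → ‖weightedCharFun σ μ t - weightedCharFun σ γ t‖ ≤ ε * B t) →
      (∀ x y, |orthantCdf γ x - orthantCdf γ y| ≤ L * ‖x - y‖) →
      ∀ x, |orthantCdf μ x - orthantCdf γ x| ≤ c * (ε * (∫ t, B t) + (A + L) / T) := by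
  obtain ⟨c, hc, hker⟩ := exists_smoothing_kernel (EuclideanSpace ℝ (Fin m))
  set W := ∫ y, (expWeight σ y)⁻¹ with hW
  have hW0 : 0 ≤ W := integral_nonneg fun y => inv_nonneg.2 (by linarith [hw y])
  refine ⟨c * (2 * W + 16), by positivity, ?_⟩
  intro μ γ _ _ T ε A L B hT hε hL hμ hγ hμA hγA hB hB0 hFour hLip x
  obtain ⟨K, ψ, hKc, hK0, hK1, hKi, hKi1, hKcT, hψ, hψc, hψT, hK⟩ := hker T hT
  have hB0' : 0 ≤ ∫ t, B t := integral_nonneg hB0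
  have hA0 : 0 ≤ A := (integral_nonneg fun y => zero_le_one.trans (hw y)).trans hμA
  have hKM : ∀ x, ‖K x‖ ≤ ∫ t, ‖ψ t‖ := fun x => by
    rw [← Complex.norm_real, hK]
    refine norm_integral_le_of_norm_le hψ.norm (ae_of_all _ fun t => ?_)
    rw [norm_mul, Complex.norm_exp_ofReal_mul_I, mul_one]
  have hsm : ∀ x, |∫ z, K z * (orthantCdf μ (x + z.ofLp) - orthantCdf γ (x + z.ofLp))| ≤
      c * ε * (∫ t, B t) * W + 2 * (A * (c / T)) := by
    intro x
    set O := {q : EuclideanSpace ℝ (Fin m) | ∀ l, q l ≤ x l} with hO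
    have hOm : MeasurableSet O := measurableSet_orthant x
    have hbi : Integrable (O.indicator fun q => (expWeight σ q)⁻¹) := hwi.indicator hOm
    obtain ⟨hIμ, hJμ⟩ := weighted_eq_integral_density hμ hKc hKM hbi
    obtain ⟨hIγ, hJγ⟩ := weighted_eq_integral_density hγ hKc hKM hbi
    have h1 := abs_weighted_sub_smoothed_le hσ hw hμ hKc hK0 hKi hKi1 hOm
    have h2 := abs_weighted_sub_smoothed_le hσ hw hγ hKc hK0 hKi hKi1 hOm
    obtain ⟨hSμ, hSμ'⟩ := integral_smoothed_orthant (μ := μ) hKi x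
    obtain ⟨hSγ, hSγ'⟩ := integral_smoothed_orthant (μ := γ) hKi x
    have h3 : |(∫ q, O.indicator (fun q => (expWeight σ q)⁻¹) q *
          ∫ y, expWeight σ y * K (y - q) ∂μ) -
        ∫ q, O.indicator (fun q => (expWeight σ q)⁻¹) q * ∫ y, expWeight σ y * K (y - q) ∂γ| ≤
        c * ε * (∫ t, B t) * W := by
      rw [← integral_sub hIμ hIγ, hW, ← integral_const_mul, ← Real.norm_eq_abs]
      refine norm_integral_le_of_norm_le (hwi.const_mul _) (ae_of_all _ fun q => ?_)
      rw [← mul_sub, norm_mul, mul_comm]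
      refine mul_le_mul (abs_integral_expWeight_mul_kernel_sub_le hμ hγ hψ hK hψc hψT hB hB0 hε
        hFour q) ?_ (norm_nonneg _) (by positivity)
      have hwq : 0 ≤ (expWeight σ q)⁻¹ := inv_nonneg.2 (by linarith [hw q])
      by_cases hq : q ∈ O
      · rw [Set.indicator_of_mem hq, Real.norm_of_nonneg hwq]
      · simpa [hq] using hwq
    have h4 : (∫ y, expWeight σ y ∂μ) * ∫ x, ‖x‖ * K x ≤ A * (c / T) :=
      mul_le_mul hμA hKcT (integral_nonneg fun x => mul_nonneg (norm_nonneg _) (hK0 x)) hA0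
    have h5 : (∫ y, expWeight σ y ∂γ) * ∫ x, ‖x‖ * K x ≤ A * (c / T) :=
      mul_le_mul hγA hKcT (integral_nonneg fun x => mul_nonneg (norm_nonneg _) (hK0 x)) hA0
    rw [hJμ, hSμ'] at h1
    rw [hJγ, hSγ'] at h2
    simp only [mul_sub]
    rw [integral_sub hSμ hSγ]
    rw [abs_le] at h1 h2 h3 ⊢
    constructor <;> linarith
  have hint : ∀ x, Integrable fun z : EuclideanSpace ℝ (Fin m) =>
      K z * (orthantCdf μ (x + z.ofLp) - orthantCdf γ (x + z.ofLp)) := fun x => by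
    simp only [mul_sub]
    exact (integral_smoothed_orthant hKi x).1.sub (integral_smoothed_orthant hKi x).1
  refine (abs_sub_le_of_smoothed (orthantCdf_mono μ) (orthantCdf_nonneg μ) (orthantCdf_le_one μ)
    (orthantCdf_nonneg γ) (orthantCdf_le_one γ) hLip hL hK0 hK1 hKi hKi1 (by positivity) hKcT hint
    hsm x).trans ?_
  have e : c * (2 * W + 16) * (ε * (∫ t, B t) + (A + L) / T) =
      (2 * (c * ε * (∫ t, B t) * W + 2 * (A * (c / T))) + 16 * (c / T) * L) +
        (16 * c * ε * (∫ t, B t) + 2 * W * c * (A + L) / T + 12 * A * c / T) := by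
    field_simp
    ring
  rw [e]
  have : 0 ≤ 16 * c * ε * (∫ t, B t) + 2 * W * c * (A + L) / T + 12 * A * c / T := by positivity
  linarith

end Smoothing

/-! ### The normalised random vectors -/

section Normalised

lemma pairing_normalised {m : ℕ} {u : (Fin m → ℂ) → ℂ} {S : ℕ → Type*}
    {Ω : ∀ n, S n → EuclideanSpace ℝ (Fin m)} {φ : ℕ → ℝ}
    (hG : ∀ j, (grad u j : ℂ) = cGrad u j) (n : ℕ) (ω : S n)
    (s : Fin m → ℂ) : pairing (normalised u φ Ω n ω) s =
      pairing (Ω n ω) (((√(φ n) : ℝ) : ℂ)⁻¹ • s) - √(φ n) * ∑ j, cGrad u j * s j := by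
  have h : ((√(φ n) : ℝ) : ℂ) = ((√(φ n) : ℝ) : ℂ)⁻¹ * φ n := by
    rw [← Complex.ofReal_inv, ← Complex.ofReal_mul, inv_mul_eq_div, Real.div_sqrt]
  have h2 : √(φ n) * ∑ j, cGrad u j * s j = ((√(φ n) : ℝ) : ℂ)⁻¹ * φ n * ∑ j, cGrad u j * s j := by
    rw [← h]
  rw [h2, pairing, pairing, Finset.mul_sum, ← Finset.sum_sub_distrib]
  refine Finset.sum_congr rfl fun j _ => ?_
  simp only [normalised, PiLp.smul_apply, PiLp.sub_apply, smul_eq_mul, Pi.smul_apply, ← hG]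
  push_cast
  ring

lemma exp_pairing_normalised {m : ℕ} {u : (Fin m → ℂ) → ℂ} {S : ℕ → Type*}
    {Ω : ∀ n, S n → EuclideanSpace ℝ (Fin m)} {φ : ℕ → ℝ}
    (hG : ∀ j, (grad u j : ℂ) = cGrad u j) (n : ℕ) (ω : S n)
    (s : Fin m → ℂ) : Complex.exp (pairing (normalised u φ Ω n ω) s) =
      Complex.exp (-(√(φ n) * ∑ j, cGrad u j * s j)) *
        Complex.exp (pairing (Ω n ω) (((√(φ n) : ℝ) : ℂ)⁻¹ • s)) := by
  rw [pairing_normalised hG, ← Complex.exp_add]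
  congr 1
  ring

variable {m : ℕ} {u : (Fin m → ℂ) → ℂ} {S : ℕ → Type*} [∀ n, MeasurableSpace (S n)]
  {P : ∀ n, Measure (S n)} {Ω : ∀ n, S n → EuclideanSpace ℝ (Fin m)}
  {φ : ℕ → ℝ} {C r : ℝ}

@[fun_prop]
lemma measurable_normalised (u : (Fin m → ℂ) → ℂ) (φ : ℕ → ℝ) (n : ℕ) (hΩ : Measurable (Ω n)) :
    Measurable (normalised u φ Ω n) := by
  unfold normalised
  fun_prop

lemma integral_exp_pairing_map_normalised (hΩ : ∀ n, Measurable (Ω n))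
    (hG : ∀ j, (grad u j : ℂ) = cGrad u j) (n : ℕ) (s : Fin m → ℂ) :
    ∫ y, Complex.exp (pairing y s) ∂((P n).map (normalised u φ Ω n)) =
      Complex.exp (-(√(φ n) * ∑ j, cGrad u j * s j)) *
        ∫ ω, Complex.exp (pairing (Ω n ω) (((√(φ n) : ℝ) : ℂ)⁻¹ • s)) ∂(P n) := by
  rw [integral_map (measurable_normalised u φ n (hΩ n)).aemeasurable (by fun_prop),
    ← integral_const_mul]
  simp only [exp_pairing_normalised hG]

/-- The vector `σ + i t` of `ℂ^m`. -/
def complexPoint (σ t : EuclideanSpace ℝ (Fin m)) : Fin m → ℂ :=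
  fun j => (σ j : ℂ) + t j * Complex.I

lemma pairing_complexPoint (y σ t : EuclideanSpace ℝ (Fin m)) :
    pairing y (complexPoint σ t) = (⟪σ, y⟫ : ℂ) + ⟪t, y⟫ * Complex.I := by
  simp only [pairing, complexPoint, PiLp.inner_apply, RCLike.inner_apply, conj_trivial]
  push_cast
  rw [Finset.sum_mul, ← Finset.sum_add_distrib]
  exact Finset.sum_congr rfl fun j _ => by ring

lemma norm_complexPoint_le (σ t : EuclideanSpace ℝ (Fin m)) :
    ‖complexPoint σ t‖ ≤ ‖σ‖ + ‖t‖ := by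
  refine (pi_norm_le_iff_of_nonneg (by positivity)).2 fun j => (norm_add_le _ _).trans ?_
  rw [norm_mul, Complex.norm_I, mul_one, Complex.norm_real, Complex.norm_real]
  exact add_le_add (PiLp.norm_apply_le σ j) (PiLp.norm_apply_le t j)

lemma tendstoInDistribution_normalised [∀ n, IsProbabilityMeasure (P n)]
    (h : HasExpansion u P Ω φ C r) (hC : 0 < C) (hr : 0 < r) (hφ : Tendsto φ atTop atTop)
    (hu : AnalyticAt ℂ u 0) (hΩ : ∀ n, Measurable (Ω n)) :
    TendstoInDistribution (normalised u φ Ω) atTop id P (multivariateGaussian 0 (hess u)) := by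
  have hG := h.ofReal_grad hC hr hφ
  have hchar : ∀ (μ : Measure (EuclideanSpace ℝ (Fin m))) (t : EuclideanSpace ℝ (Fin m)),
      charFun μ t = ∫ y, Complex.exp (pairing y (complexPoint 0 t)) ∂μ := by
    intro μ t
    rw [charFun_apply]
    simp only [pairing_complexPoint, inner_zero_left, Complex.ofReal_zero, zero_add,
      real_inner_comm]
  refine ⟨fun n => (measurable_normalised u φ n (hΩ n)).aemeasurable, by fun_prop, ?_⟩
  refine ProbabilityMeasure.tendsto_iff_tendsto_charFun.2 fun t => ?_
  simp only [ProbabilityMeasure.coe_mk, Measure.map_id, hchar]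
  rw [integral_exp_pairing_multivariateGaussian (h.posSemidef_hess hC hr hφ hu),
    h.map_ofReal_hess hC hr hφ hu]
  simp only [integral_exp_pairing_map_normalised hΩ hG]
  exact h.tendsto_mgf hC hr hφ _

end Normalised

section Weight

variable {m : ℕ}

/-- The exponents of the weight `1 + ∑ j, (exp y_j + exp (-y_j))`. -/
def crossPoints (m : ℕ) : Option (Fin m × Bool) → EuclideanSpace ℝ (Fin m)
  | none => 0
  | some (j, true) => EuclideanSpace.single j 1
  | some (j, false) => EuclideanSpace.single j (-1)

lemma norm_crossPoints_le (i : Option (Fin m × Bool)) : ‖crossPoints m i‖ ≤ 1 := by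
  rcases i with _ | ⟨j, _ | _⟩ <;> simp [crossPoints]

lemma exp_inner_crossPoints_le (i : Option (Fin m × Bool)) (y : EuclideanSpace ℝ (Fin m)) :
    Real.exp ⟪crossPoints m i, y⟫ ≤ expWeight (crossPoints m) y :=
  Finset.single_le_sum (f := fun i => Real.exp ⟪crossPoints m i, y⟫)
    (fun _ _ => (Real.exp_pos _).le) (Finset.mem_univ i)

lemma one_le_expWeight_crossPoints (y : EuclideanSpace ℝ (Fin m)) :
    1 ≤ expWeight (crossPoints m) y := by
  simpa [crossPoints] using exp_inner_crossPoints_le none y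

/-- The logarithm of the weight dominates `max |y_j|`, so that the weight grows faster than every
power of `‖y‖`. -/
lemma integrable_inv_expWeight_crossPoints :
    Integrable fun y : EuclideanSpace ℝ (Fin m) => (expWeight (crossPoints m) y)⁻¹ := by
  have hbase : Integrable fun y : EuclideanSpace ℝ (Fin m) => (1 + ‖y‖) ^ (-((m : ℝ) + 1)) :=
    integrable_one_add_norm (by simp)
  refine (hbase.const_mul ((m + 1) ^ (m + 1) * (m + 1).factorial * Real.exp 1)).mono'
    (by
      have := (continuous_expWeight (crossPoints m)).measurable.inv
      exact this.aestronglyMeasurable) (ae_of_all _ fun y => ?_)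
  have hw1 := one_le_expWeight_crossPoints y
  have hw : 0 < expWeight (crossPoints m) y := by linarith
  rw [Real.norm_of_nonneg (by positivity)]
  set l := Real.log (expWeight (crossPoints m) y) with hl
  have hl0 : 0 ≤ l := Real.log_nonneg hw1
  have hcoord : ∀ j, |y j| ≤ l := fun j => by
    have h1 := exp_inner_crossPoints_le (some (j, true)) y
    have h2 := exp_inner_crossPoints_le (some (j, false)) y
    rw [← Real.le_log_iff_exp_le hw] at h1 h2
    simp only [crossPoints, EuclideanSpace.inner_single_left, conj_trivial, one_mul,
      neg_mul] at h1 h2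
    exact abs_le.2 ⟨by linarith, h1⟩
  have hnorm : ‖y‖ ≤ m * l := by
    calc ‖y‖ ≤ ∑ j, |y j| := by
          have : y = ∑ j, EuclideanSpace.single j (y j) := by
            ext i
            simp [Pi.single_apply]
          conv_lhs => rw [this]
          exact (norm_sum_le _ _).trans (by simp)
      _ ≤ ∑ _j : Fin m, l := Finset.sum_le_sum fun j _ => hcoord j
      _ = m * l := by simp
  have h1 : 1 + ‖y‖ ≤ (m + 1) * (1 + l) := by nlinarith [(Nat.cast_nonneg m : (0 : ℝ) ≤ m)]
  have h2 : (1 + l) ^ (m + 1) ≤ (m + 1).factorial * (Real.exp 1 * expWeight (crossPoints m) y) := by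
    have := Real.pow_div_factorial_le_exp (x := 1 + l) (by linarith) (m + 1)
    rw [div_le_iff₀ (by positivity), Real.exp_add, hl, Real.exp_log hw] at this
    linarith
  have h3 : (1 + ‖y‖) ^ (m + 1) ≤ (m + 1) ^ (m + 1) * (m + 1).factorial * Real.exp 1 *
      expWeight (crossPoints m) y := by
    calc (1 + ‖y‖) ^ (m + 1) ≤ ((m + 1) * (1 + l)) ^ (m + 1) := by gcongr
      _ = (m + 1) ^ (m + 1) * (1 + l) ^ (m + 1) := mul_pow _ _ _
      _ ≤ (m + 1) ^ (m + 1) * ((m + 1).factorial * (Real.exp 1 * expWeight (crossPoints m) y)) := by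
          gcongr
      _ = _ := by ring
  have h4 : (1 + ‖y‖) ^ (-((m : ℝ) + 1)) = ((1 + ‖y‖) ^ (m + 1))⁻¹ := by
    rw [Real.rpow_neg (by positivity)]
    congr 1
    exact_mod_cast Real.rpow_natCast (1 + ‖y‖) (m + 1)
  rw [h4, ← div_eq_mul_inv, inv_eq_one_div, div_le_div_iff₀ hw (by positivity), one_mul]
  exact h3

variable {ι : Type*} [Fintype ι] {σ : ι → EuclideanSpace ℝ (Fin m)}
  {μ : Measure (EuclideanSpace ℝ (Fin m))}

lemma weightedCharFun_eq_sum (t : EuclideanSpace ℝ (Fin m))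
    (h : ∀ i, Integrable (fun y => Complex.exp (pairing y (complexPoint (σ i) t))) μ) :
    weightedCharFun σ μ t = ∑ i, ∫ y, Complex.exp (pairing y (complexPoint (σ i) t)) ∂μ := by
  rw [weightedCharFun, ← integral_finsetSum _ fun i _ => h i]
  congr 1
  ext y
  rw [expWeight, Complex.ofReal_sum, Finset.sum_mul]
  refine Finset.sum_congr rfl fun i _ => ?_
  rw [pairing_complexPoint, Complex.exp_add, Complex.ofReal_exp]

lemma integrable_expWeight
    (h : ∀ i, Integrable (fun y => Complex.exp (pairing y (complexPoint (σ i) 0))) μ) :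
    Integrable (expWeight σ) μ := by
  unfold expWeight
  refine integrable_finsetSum _ fun i _ => (h i).norm.congr (ae_of_all _ fun y => ?_)
  simp [pairing_complexPoint, Complex.norm_exp]

lemma integral_expWeight_le
    (h : ∀ i, Integrable (fun y => Complex.exp (pairing y (complexPoint (σ i) 0))) μ) {M : ℝ}
    (hM : ∀ i, ‖∫ y, Complex.exp (pairing y (complexPoint (σ i) 0)) ∂μ‖ ≤ M) :
    ∫ y, expWeight σ y ∂μ ≤ Fintype.card ι * M := by
  have h1 := weightedCharFun_eq_sum 0 h
  have h2 : weightedCharFun σ μ 0 = ((∫ y, expWeight σ y ∂μ : ℝ) : ℂ) := by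
    rw [weightedCharFun, ← integral_complex_ofReal]
    simp
  calc ∫ y, expWeight σ y ∂μ ≤ ‖((∫ y, expWeight σ y ∂μ : ℝ) : ℂ)‖ := by
        rw [Complex.norm_real]; exact le_abs_self _
    _ = ‖∑ i, ∫ y, Complex.exp (pairing y (complexPoint (σ i) 0)) ∂μ‖ := by rw [← h2, h1]
    _ ≤ ∑ _i : ι, M := (norm_sum_le _ _).trans (Finset.sum_le_sum fun i _ => hM i)
    _ = _ := by simp

end Weight

section Quadratic

variable {m : ℕ} {A : Matrix (Fin m) (Fin m) ℝ}

lemma re_quadratic_complexPoint (A : Matrix (Fin m) (Fin m) ℝ) (σ t : EuclideanSpace ℝ (Fin m)) :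
    (complexPoint σ t ⬝ᵥ (A.map Complex.ofReal).mulVec (complexPoint σ t)).re =
      σ ⬝ᵥ A.mulVec σ - t ⬝ᵥ A.mulVec t := by
  simp only [dotProduct, Matrix.mulVec, complexPoint, Matrix.map_apply, Complex.re_sum,
    Finset.mul_sum, ← Finset.sum_sub_distrib]
  refine Finset.sum_congr rfl fun j _ => Finset.sum_congr rfl fun k _ => ?_
  simp

/-- A positive definite quadratic form is coercive. -/
lemma exists_quadratic_bounds (hA : A.PosDef) :
    ∃ α Λ : ℝ, 0 < α ∧ 0 < Λ ∧ ∀ σ t : EuclideanSpace ℝ (Fin m), ‖σ‖ ≤ 1 →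
      (1 / 2 * (complexPoint σ t ⬝ᵥ (A.map Complex.ofReal).mulVec (complexPoint σ t))).re ≤
        Λ - α * ‖t‖ ^ 2 := by
  set R := CFC.sqrt A with hR
  have hRR : R * R = A := CFC.sqrt_mul_sqrt_self A hA.posSemidef.nonneg
  have hRt : R.transpose = R := transpose_sqrt A
  have hdet : R.det ≠ 0 := fun h => by
    have := hA.det_pos
    rw [← hRR, Matrix.det_mul, h, mul_zero] at this
    exact this.false
  let f := Matrix.toEuclideanCLM (𝕜 := ℝ) R
  have hf : ∀ t : EuclideanSpace ℝ (Fin m), t ⬝ᵥ A.mulVec t = ‖f t‖ ^ 2 := by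
    intro t
    rw [← real_inner_self_eq_norm_sq]
    simp only [f]
    rw [← hRR, ← Matrix.mulVec_mulVec, Matrix.dotProduct_mulVec, ← Matrix.mulVec_transpose, hRt,
      EuclideanSpace.inner_eq_star_dotProduct]
    simp
  have hker : LinearMap.ker (f : EuclideanSpace ℝ (Fin m) →ₗ[ℝ] EuclideanSpace ℝ (Fin m)) = ⊥ := by
    rw [LinearMap.ker_eq_bot']
    intro t ht
    have h1 : R.mulVec t.ofLp = 0 := congrArg WithLp.ofLp ht
    have := Matrix.eq_zero_of_mulVec_eq_zero hdet h1
    exact WithLp.ofLp_injective 2 this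
  obtain ⟨κ, hκ, hanti⟩ := LinearMap.exists_antilipschitzWith _ hker
  refine ⟨1 / (2 * κ ^ 2), 1 / 2 * ‖f‖ ^ 2 + 1, by positivity, by positivity, fun σ t hσ => ?_⟩
  have h1 : ‖t‖ ≤ κ * ‖f t‖ := by
    have := hanti.le_mul_dist t 0
    simpa using this
  have h2 : ‖f σ‖ ≤ ‖f‖ := (f.le_opNorm σ).trans (mul_le_of_le_one_right (norm_nonneg _) hσ)
  have h3 : 1 / (2 * κ ^ 2) * ‖t‖ ^ 2 ≤ 1 / 2 * ‖f t‖ ^ 2 := by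
    rw [div_mul_eq_mul_div, one_mul, div_le_iff₀ (by positivity)]
    calc ‖t‖ ^ 2 ≤ (κ * ‖f t‖) ^ 2 := by gcongr
      _ = _ := by ring
  have h4 : ‖f σ‖ ^ 2 ≤ ‖f‖ ^ 2 := by gcongr
  have h5 : (1 / 2 * (complexPoint σ t ⬝ᵥ (A.map Complex.ofReal).mulVec (complexPoint σ t))).re =
      1 / 2 * (‖f σ‖ ^ 2 - ‖f t‖ ^ 2) := by
    rw [← hf, ← hf, ← re_quadratic_complexPoint A]
    simp
  rw [h5]
  linarith

lemma norm_exp_sub_one_le_mul_exp (z : ℂ) : ‖Complex.exp z - 1‖ ≤ ‖z‖ * Real.exp ‖z‖ := by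
  simpa using Complex.norm_exp_sub_sum_le_norm_mul_exp z 1

end Quadratic

/-! ### The rate of convergence -/

section Rate

variable {m : ℕ}

/-- Comparison of the moment generating functions of the normalised vectors with the Gaussian one
on the region `‖t‖ ≤ c₀ √φ_n`; here `q = √φ_n`. On that region the cubic error term is dominated by
a small multiple of the Gaussian exponent. -/
lemma exists_exp_sub_exp_le {A : Matrix (Fin m) (Fin m) ℝ} {α Λ C r : ℝ} (hα : 0 < α)
    (hC : 0 < C) (hr : 0 < r)
    (hA : ∀ σ t : EuclideanSpace ℝ (Fin m), ‖σ‖ ≤ 1 →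
      (1 / 2 * (complexPoint σ t ⬝ᵥ (A.map Complex.ofReal).mulVec (complexPoint σ t))).re ≤
        Λ - α * ‖t‖ ^ 2) :
    ∃ c₀ q₀ M : ℝ, 0 < c₀ ∧ 0 < q₀ ∧ 0 < M ∧ ∀ q, q₀ ≤ q →
      ∀ σ t : EuclideanSpace ℝ (Fin m), ‖σ‖ ≤ 1 → ‖t‖ ≤ c₀ * q →
        ‖complexPoint σ t‖ ≤ r * q ∧
        ∀ D : ℂ, ‖D‖ ≤ C * (‖complexPoint σ t‖ + ‖complexPoint σ t‖ ^ 3) / q →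
          ‖Complex.exp (1 / 2 * (complexPoint σ t ⬝ᵥ
              (A.map Complex.ofReal).mulVec (complexPoint σ t)) + D)‖ ≤ Real.exp (Λ + α) ∧
          ‖Complex.exp (1 / 2 * (complexPoint σ t ⬝ᵥ
              (A.map Complex.ofReal).mulVec (complexPoint σ t)) + D) -
            Complex.exp (1 / 2 * (complexPoint σ t ⬝ᵥ
              (A.map Complex.ofReal).mulVec (complexPoint σ t)))‖ ≤
            q⁻¹ * (M * Real.exp (-(α / 2) * ‖t‖ ^ 2)) := by
  refine ⟨min (α / (16 * C)) (r / 2), max (16 * C / α) (2 / r),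
    2 * C * Real.exp (Λ + α + 9 / α), by positivity, by positivity, by positivity, ?_⟩
  intro q hq σ t hσ ht
  have hq1 : 16 * C / α ≤ q := (le_max_left _ _).trans hq
  have hq2 : 2 / r ≤ q := (le_max_right _ _).trans hq
  have hq0 : 0 < q := lt_of_lt_of_le (by positivity) hq1
  have ht1 : ‖t‖ ≤ α / (16 * C) * q := ht.trans (by gcongr; exact min_le_left _ _)
  have ht2 : ‖t‖ ≤ r / 2 * q := ht.trans (by gcongr; exact min_le_right _ _)
  have ht0 := norm_nonneg t
  set s := complexPoint σ t with hs
  have hsx : ‖s‖ ≤ 1 + ‖t‖ := (norm_complexPoint_le σ t).trans (by linarith)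
  refine ⟨?_, fun D hD => ?_⟩
  · have : 1 ≤ r / 2 * q := by
      rw [div_le_iff₀ hr] at hq2
      linarith
    linarith
  set Q := 1 / 2 * (s ⬝ᵥ (A.map Complex.ofReal).mulVec s) with hQ
  have hQre : Q.re ≤ Λ - α * ‖t‖ ^ 2 := hA σ t hσ
  set x := 1 + ‖t‖ with hx
  have hx1 : 1 ≤ x := by linarith
  have hD1 : ‖D‖ ≤ C * (x + x ^ 3) / q := hD.trans (by gcongr)
  have hCx : C * x ≤ α / 8 * q := by
    have h1 : C ≤ α / 16 * q := by
      rw [div_le_iff₀ hα] at hq1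
      linarith
    have h2 : C * ‖t‖ ≤ α / 16 * q := by
      calc C * ‖t‖ ≤ C * (α / (16 * C) * q) := by gcongr
        _ = α / 16 * q := by field_simp
    rw [hx, mul_add, mul_one]
    linarith
  have hD2 : ‖D‖ ≤ 3 * α / 8 + α / 4 * ‖t‖ ^ 2 := by
    refine hD1.trans ?_
    rw [div_le_iff₀ hq0]
    have h1 : C * (x + x ^ 3) = C * x * (1 + x ^ 2) := by ring
    have h2 : 1 + x ^ 2 ≤ 3 + 2 * ‖t‖ ^ 2 := by
      rw [hx]; nlinarith [sq_nonneg (‖t‖ - 1)]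
    rw [h1]
    calc C * x * (1 + x ^ 2) ≤ α / 8 * q * (3 + 2 * ‖t‖ ^ 2) := by gcongr
      _ = _ := by ring
  have ht3 : 0 ≤ α * ‖t‖ ^ 2 := by positivity
  have hexp : Real.exp Q.re * Real.exp ‖D‖ ≤
      Real.exp (Λ + α) * Real.exp (-(3 / 4 * α) * ‖t‖ ^ 2) := by
    rw [← Real.exp_add, ← Real.exp_add]
    refine Real.exp_le_exp.2 ?_
    linarith
  constructor
  · rw [Complex.exp_add, norm_mul, Complex.norm_exp]
    have h1 : ‖Complex.exp D‖ ≤ Real.exp ‖D‖ := Complex.norm_exp_le_exp_norm D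
    have h2 : Real.exp (-(3 / 4 * α) * ‖t‖ ^ 2) ≤ 1 := Real.exp_le_one_iff.2 (by linarith)
    calc Real.exp Q.re * ‖Complex.exp D‖ ≤ Real.exp Q.re * Real.exp ‖D‖ := by gcongr
      _ ≤ Real.exp (Λ + α) * Real.exp (-(3 / 4 * α) * ‖t‖ ^ 2) := hexp
      _ ≤ Real.exp (Λ + α) := mul_le_of_le_one_right (Real.exp_pos _).le h2
  · have e : Complex.exp (Q + D) - Complex.exp Q = Complex.exp Q * (Complex.exp D - 1) := by
      rw [Complex.exp_add]; ring
    have hpoly : x + x ^ 3 ≤ 2 * Real.exp (3 * ‖t‖) := by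
      have h1 : x ≤ Real.exp ‖t‖ := by
        rw [hx]; linarith [Real.add_one_le_exp ‖t‖]
      have h2 : x ^ 3 ≤ Real.exp (3 * ‖t‖) := by
        rw [show 3 * ‖t‖ = ((3 : ℕ) : ℝ) * ‖t‖ by norm_num, Real.exp_nat_mul]
        gcongr
      have h3 : x ≤ x ^ 3 := le_self_pow₀ hx1 (by norm_num)
      linarith
    have hamgm : 3 * ‖t‖ ≤ α / 4 * ‖t‖ ^ 2 + 9 / α := by
      have h1 : α / 4 * ‖t‖ ^ 2 + 9 / α - 3 * ‖t‖ = (α * ‖t‖ - 6) ^ 2 / (4 * α) := by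
        field_simp
        ring
      have h2 : 0 ≤ (α * ‖t‖ - 6) ^ 2 / (4 * α) := by positivity
      linarith
    rw [e, norm_mul, Complex.norm_exp]
    calc Real.exp Q.re * ‖Complex.exp D - 1‖ ≤ Real.exp Q.re * (‖D‖ * Real.exp ‖D‖) := by
          gcongr; exact norm_exp_sub_one_le_mul_exp D
      _ = ‖D‖ * (Real.exp Q.re * Real.exp ‖D‖) := by ring
      _ ≤ (C * (2 * Real.exp (α / 4 * ‖t‖ ^ 2 + 9 / α)) / q) *
          (Real.exp (Λ + α) * Real.exp (-(3 / 4 * α) * ‖t‖ ^ 2)) := by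
          refine mul_le_mul (hD1.trans ?_) hexp (by positivity) (by positivity)
          have := hpoly.trans (mul_le_mul_of_nonneg_left (Real.exp_le_exp.2 hamgm) zero_le_two)
          gcongr
      _ = q⁻¹ * (2 * C * (Real.exp (α / 4 * ‖t‖ ^ 2 + 9 / α) *
          (Real.exp (Λ + α) * Real.exp (-(3 / 4 * α) * ‖t‖ ^ 2)))) := by
          field_simp
      _ = _ := by
          have : Real.exp (α / 4 * ‖t‖ ^ 2 + 9 / α) *
              (Real.exp (Λ + α) * Real.exp (-(3 / 4 * α) * ‖t‖ ^ 2)) =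
              Real.exp (Λ + α + 9 / α) * Real.exp (-(α / 2) * ‖t‖ ^ 2) := by
            rw [← Real.exp_add, ← Real.exp_add, ← Real.exp_add]
            congr 1
            ring
          rw [this, mul_assoc (2 * C)]

/-- The Berry–Esseen bound for the normalised vectors. -/
lemma exists_orthantCdf_bound {u : (Fin m → ℂ) → ℂ} (hPD : (hess u).PosDef)
    (hH : (hess u).map Complex.ofReal = cHess u)
    (hG : ∀ j, (grad u j : ℂ) = cGrad u j) {C r : ℝ} (hC : 0 < C) (hr : 0 < r) :
    ∃ c : ℝ, ∀ (S : ℕ → Type*) [∀ n, MeasurableSpace (S n)] (P : ∀ n, Measure (S n))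
      [∀ n, IsProbabilityMeasure (P n)] (Ω : ∀ n, S n → EuclideanSpace ℝ (Fin m)) (φ : ℕ → ℝ),
      (∀ n, Measurable (Ω n)) → HasExpansion u P Ω φ C r → Tendsto φ atTop atTop →
      ∀ᶠ n in atTop, ∀ x, |orthantCdf ((P n).map (normalised u φ Ω n)) x -
        orthantCdf (multivariateGaussian 0 (hess u)) x| ≤ c / √(φ n) := by
  set A := hess u with hA
  obtain ⟨α, Λ, hα, hΛ, hquad⟩ := exists_quadratic_bounds hPD
  obtain ⟨c₀, q₀, M, hc₀, hq₀, hM, hcomp⟩ := exists_exp_sub_exp_le hα hC hr hquad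
  obtain ⟨L, hL, hslab⟩ := multivariateGaussian_slab_le hPD
  obtain ⟨c, hc, hsmooth⟩ := exists_smoothing_inequality (crossPoints m) norm_crossPoints_le
    one_le_expWeight_crossPoints integrable_inv_expWeight_crossPoints
  set N : ℝ := (Fintype.card (Option (Fin m × Bool)) : ℝ) with hN
  let B : EuclideanSpace ℝ (Fin m) → ℝ := fun t => N * (M * Real.exp (-(α / 2) * ‖t‖ ^ 2))
  have hB : Integrable B := by
    have h1 := GaussianFourier.integrable_cexp_neg_mul_sq_norm_add
      (V := EuclideanSpace ℝ (Fin m)) (b := ((α / 2 : ℝ) : ℂ))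
      (by rw [Complex.ofReal_re]; positivity) 0 0
    refine ((h1.norm.const_mul M).const_mul N).congr (ae_of_all _ fun t => ?_)
    simp only [B]
    rw [zero_mul, add_zero, ← Complex.ofReal_neg, ← Complex.ofReal_pow, ← Complex.ofReal_mul,
      ← Complex.ofReal_exp, Complex.norm_real, Real.norm_of_nonneg (Real.exp_pos _).le]
  refine ⟨c * ((∫ t, B t) + (N * Real.exp (Λ + α) + m * L) / c₀), ?_⟩
  intro S _ P _ Ω φ hΩ hexp hφ
  have hq := tendsto_sqrt_of_tendsto hφ
  filter_upwards [hexp, hq.eventually_ge_atTop q₀] with n hn hqn x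
  set q := √(φ n) with hqdef
  have hq0 : 0 < q := hq₀.trans_le hqn
  set μ := (P n).map (normalised u φ Ω n) with hμ
  have hmeas := measurable_normalised u φ n (hΩ n)
  have : IsProbabilityMeasure μ := Measure.isProbabilityMeasure_map hmeas.aemeasurable
  have hmgf : ∀ s : Fin m → ℂ, ‖s‖ ≤ r * q → Integrable (fun y => Complex.exp (pairing y s)) μ ∧
      ∃ D : ℂ, ‖D‖ ≤ C * (‖s‖ + ‖s‖ ^ 3) / q ∧ ∫ y, Complex.exp (pairing y s) ∂μ =
        Complex.exp (1 / 2 * (s ⬝ᵥ (A.map Complex.ofReal).mulVec s) + D) := by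
    intro s hs
    obtain ⟨hint, D, hD, hval⟩ := hn s hs
    refine ⟨?_, D, hD, ?_⟩
    · rw [hμ, integrable_map_measure (by fun_prop) hmeas.aemeasurable]
      simp only [Function.comp_def, exp_pairing_normalised hG]
      exact hint.const_mul _
    · rw [hμ, integral_exp_pairing_map_normalised hΩ hG, hval, ← Complex.exp_add, hH]
      congr 1
      ring
  have h0 : ‖(0 : EuclideanSpace ℝ (Fin m))‖ ≤ c₀ * q := by
    rw [norm_zero]; positivity
  have hint : ∀ (t : EuclideanSpace ℝ (Fin m)), ‖t‖ ≤ c₀ * q → ∀ i,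
      Integrable (fun y => Complex.exp (pairing y (complexPoint (crossPoints m i) t))) μ :=
    fun t ht i => (hmgf _ (hcomp q hqn _ t (norm_crossPoints_le i) ht).1).1
  have hintγ : ∀ (t : EuclideanSpace ℝ (Fin m)) i, Integrable
      (fun y => Complex.exp (pairing y (complexPoint (crossPoints m i) t)))
      (multivariateGaussian 0 A) :=
    fun t i => integrable_exp_pairing_multivariateGaussian _ _
  have hA1 : ∫ y, expWeight (crossPoints m) y ∂μ ≤ N * Real.exp (Λ + α) := by
    refine integral_expWeight_le (hint 0 h0) fun i => ?_
    obtain ⟨hs, hb⟩ := hcomp q hqn _ 0 (norm_crossPoints_le i) h0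
    obtain ⟨-, D, hD, hval⟩ := hmgf _ hs
    rw [hval]
    exact (hb D hD).1
  have hA2 : ∫ y, expWeight (crossPoints m) y ∂(multivariateGaussian 0 A) ≤
      N * Real.exp (Λ + α) := by
    refine integral_expWeight_le (hintγ 0) fun i => ?_
    obtain ⟨hs, hb⟩ := hcomp q hqn _ 0 (norm_crossPoints_le i) h0
    rw [integral_exp_pairing_multivariateGaussian hPD.posSemidef]
    simpa using (hb 0 (by rw [norm_zero]; positivity)).1
  have hF : ∀ t, ‖t‖ ≤ c₀ * q → ‖weightedCharFun (crossPoints m) μ t -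
      weightedCharFun (crossPoints m) (multivariateGaussian 0 A) t‖ ≤ q⁻¹ * B t := by
    intro t ht
    rw [weightedCharFun_eq_sum t (hint t ht), weightedCharFun_eq_sum t (hintγ t),
      ← Finset.sum_sub_distrib]
    calc _ ≤ ∑ _i : Option (Fin m × Bool), q⁻¹ * (M * Real.exp (-(α / 2) * ‖t‖ ^ 2)) := by
          refine (norm_sum_le _ _).trans (Finset.sum_le_sum fun i _ => ?_)
          obtain ⟨hs, hb⟩ := hcomp q hqn _ t (norm_crossPoints_le i) ht
          obtain ⟨-, D, hD, hval⟩ := hmgf _ hs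
          rw [hval, integral_exp_pairing_multivariateGaussian hPD.posSemidef]
          exact (hb D hD).2
      _ = q⁻¹ * B t := by
          rw [Finset.sum_const, Finset.card_univ, nsmul_eq_mul]
          simp only [B, hN]
          ring
  refine (hsmooth μ (multivariateGaussian 0 A) (c₀ * q) q⁻¹ (N * Real.exp (Λ + α)) (m * L) B
    (by positivity) (by positivity) (by positivity) (integrable_expWeight (hint 0 h0))
    (integrable_expWeight (hintγ 0)) hA1 hA2 hB (fun t => by positivity) hF
    (orthantCdf_lipschitz _ hL hslab) x).trans (le_of_eq ?_)
  field_simp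

end Rate

end QuasiPower

end

theorem theorem1 {m : ℕ} {τ : ℝ} (hτ : 0 < τ) {u v : (Fin m → ℂ) → ℂ}
    (hu : AnalyticOnNhd ℂ u {s | ‖s‖ ≤ τ}) (hv : AnalyticOnNhd ℂ v {s | ‖s‖ ≤ τ}) :
    ∃ C : ℝ, ∀ (S : ℕ → Type*) [∀ n, MeasurableSpace (S n)] (P : ∀ n, Measure (S n))
      [∀ n, IsProbabilityMeasure (P n)] (Ω : ∀ n, S n → EuclideanSpace ℝ (Fin m))
      (φ κ : ℕ → ℝ), (∀ n, Measurable (Ω n)) → QuasiPower.IsQuasiPower τ u v φ κ P Ω →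
      -- the gradient and the Hessian are real, and the Hessian is a covariance matrix
      (∀ j, (QuasiPower.grad u j : ℂ) = QuasiPower.cGrad u j) ∧
      (QuasiPower.hess u).map Complex.ofReal = QuasiPower.cHess u ∧
      (QuasiPower.hess u).PosSemidef ∧
      -- convergence in distribution, whether the Hessian is singular or not
      TendstoInDistribution (QuasiPower.normalised u φ Ω) atTop id P
        (multivariateGaussian 0 (QuasiPower.hess u)) ∧
      -- speed of convergence for a non-singular Hessian
      ((QuasiPower.cHess u).det ≠ 0 →
        (QuasiPower.hess u).PosDef ∧
        ∀ᶠ n in atTop, ∀ x : Fin m → ℝ,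
          |(P n).real {ω | ∀ l, QuasiPower.normalised u φ Ω n ω l ≤ x l} -
            QuasiPower.normalCdf (QuasiPower.hess u) x| ≤ C / √(φ n)) := by
  obtain ⟨C, r, hC, hr, hexp⟩ := QuasiPower.exists_hasExpansion hτ hu hv
  have hu0 : AnalyticAt ℂ u 0 := hu 0 (by simp [hτ.le])
  -- the constant is chosen before the random vectors, so that the case distinction comes first
  by_cases hcase : (QuasiPower.hess u).PosDef ∧
      (QuasiPower.hess u).map Complex.ofReal = QuasiPower.cHess u ∧
      ∀ j, (QuasiPower.grad u j : ℂ) = QuasiPower.cGrad u j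
  · obtain ⟨c, hc⟩ := QuasiPower.exists_orthantCdf_bound hcase.1 hcase.2.1 hcase.2.2 hC hr
    refine ⟨c, ?_⟩
    intro S _ P _ Ω φ κ hΩ hQ
    have h := hexp S P Ω φ κ hΩ hQ
    refine ⟨hcase.2.2, hcase.2.1, hcase.1.posSemidef,
      QuasiPower.tendstoInDistribution_normalised h hC hr hQ.tendsto_φ hu0 hΩ,
      fun _ => ⟨hcase.1, ?_⟩⟩
    filter_upwards [hc S P Ω φ hΩ h hQ.tendsto_φ] with n hn x
    have h1 := hn x
    rw [QuasiPower.orthantCdf, QuasiPower.orthantCdf,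
      QuasiPower.multivariateGaussian_real_orthant hcase.1,
      map_measureReal_apply (QuasiPower.measurable_normalised u φ n (hΩ n))
        (QuasiPower.measurableSet_orthant x)] at h1
    exact h1
  · refine ⟨0, ?_⟩
    intro S _ P _ Ω φ κ hΩ hQ
    have h := hexp S P Ω φ κ hΩ hQ
    have hG := h.ofReal_grad hC hr hQ.tendsto_φ
    have hH := h.map_ofReal_hess hC hr hQ.tendsto_φ hu0
    have hps := h.posSemidef_hess hC hr hQ.tendsto_φ hu0
    refine ⟨hG, hH, hps,
      QuasiPower.tendstoInDistribution_normalised h hC hr hQ.tendsto_φ hu0 hΩ, fun hdet => ?_⟩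
    refine absurd ⟨hps.posDef_iff_det_ne_zero.2 fun h0 => hdet ?_, hH, hG⟩ hcase
    rw [← hH]
    have := (Complex.ofRealHom.map_det (QuasiPower.hess u)).symm
    rw [h0, map_zero] at this
    exact this
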